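/- **Theorem 1.10.** Let $m\ge 1$, let $0=k_0<k_1<\dots<k_m<k_{m+1}=d$ be integers, and let $$A=\begin{pmatrix}1&1&\cdots&1&1\\ 0&k_1&\cdots&k_m&d\end{pmatrix},\qquad x=(x_0,x_{k_1},\dots,x_{k_m},x_d),\qquad f(x;t)=x_0+x_{k_1}t^{k_1}+\dots+x_{k_m}t^{k_m}+x_dt^d .$$ For $\alpha=(\alpha_1,\alpha_2)\in\mathbb C^2$, a *rational solution* of the $A$-hypergeometric system with exponent $\alpha$ is a rational function $\varphi\in\mathbb C(x)$ with $$\Bigl(\prod_{v_j>0}\partial_j^{\,v_j}-\prod_{v_j<0}\partial_j^{\,-v_j}\Bigr)\varphi=0\quad\text{for all } v\in\mathbb Z^{m+2}\text{ with }Av=0,\qquad \sum_j A_{ij}\,x_j\,\partial_j\varphi=\alpha_i\varphi\quad(i=1,2).$$ For an integer matrix $M$ with $q$ columns and first row $(1,\dots,1)$, and an integer vector $\beta$, put $\Phi^M(\beta;y)=\sum_{u\in\mathbb N^q,\ Mu=\beta}y^u/u!$. Let $B$, respectively $C$, be $A$ without its last, respectively first, column, let $x'$, respectively $\tilde x$,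 be $x$ without $x_d$, respectively $x_0$, and for $\alpha\in\mathbb Z^2$ put $$\Psi^A_d(\alpha;x)=\sum_{r\ge1}(-1)^r(r-1)!\,\frac{\Phi^B(\alpha+r(1,d);x')}{x_d^{\,r}},\qquad \Psi^A_0(\alpha;x)=\sum_{r\ge1}(-1)^r(r-1)!\,\frac{\Phi^C(\alpha+r(1,0);\tilde x)}{x_0^{\,r}}$$ (all these sums are finite). Then: 1. For every $\alpha\in\mathbb C^2$, every rational solution with exponent $\alpha$ is a Laurent polynomial. Its reduced denominator divides a monomial $x_0^ax_d^b$; in particular no irreducible factor of the discriminant of $f(x;t)$ with respect to $t$, other than $x_0$ and $x_d$ (up to constants), divides that denominator. 2. If $\alpha\in\mathbb C^2\setminus\mathbb Z^2$, the only rational solution with exponent $\alpha$ is $0$. 3. If $\alpha\in A\cdot\mathbb N^{m+2}$, the rational solutions with exponent $\alpha$ are exactly the functions $c\,\Phi^A(\alpha;x)$ with $c\in\mathbb C$. 4. If $\alpha\in\mathbb Z^2\setminus A\cdot\mathbb N^{m+2}$, the rational solutions with exponent $\alpha$ are exactly the functions $c_0\,\Psi^A_0(\alpha;x)+c_d\,\Psi^A_d(\alpha;x)$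 with $c_0,c_d\in\mathbb C$. -/

import Mathlib

noncomputable section

namespace GKZ

/-- The field `ℂ(x₁, …, x_r)` of rational functions in `r` variables. -/
abbrev RatFun (r : ℕ) : Type := FractionRing (MvPolynomial (Fin r) ℂ)

/-- The inclusion of polynomials into rational functions. -/
abbrev ofPoly {r : ℕ} (P : MvPolynomial (Fin r) ℂ) : RatFun r :=
  algebraMap (MvPolynomial (Fin r) ℂ) (RatFun r) P

/-- The variable `x_j` as a rational function. -/
abbrev var {r : ℕ} (j : Fin r) : RatFun r := ofPoly (MvPolynomial.X j)

section FractionField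

variable {F R K : Type*} [Field F] [CommRing R] [IsDomain R] [UniqueFactorizationMonoid R]
  [Algebra F R] [Field K] [Algebra R K] [IsFractionRing R K]

/-- The derivative of the reduced fraction `P / Q` by the quotient rule, for a derivation `D`
of `R` and `P, Q ∈ R`. -/
def quotDeriv (D : Derivation F R R) (y : K) : K :=
  (algebraMap R K (D (IsFractionRing.num R y)) * algebraMap R K (IsFractionRing.den R y) -
    algebraMap R K (IsFractionRing.num R y) * algebraMap R K (D (IsFractionRing.den R y))) /
      algebraMap R K (IsFractionRing.den R y) ^ 2

/-- The quotient rule holds for every representation as a fraction, reduced or not. -/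
theorem quotDeriv_div (D : Derivation F R R) (P Q : R) (hQ : Q ≠ 0) :
    quotDeriv D (algebraMap R K P / algebraMap R K Q) =
      (algebraMap R K (D P) * algebraMap R K Q - algebraMap R K P * algebraMap R K (D Q)) /
        algebraMap R K Q ^ 2 := by
  have inj := IsFractionRing.injective R K
  have h1 := IsFractionRing.mk'_num_den' R (algebraMap R K P / algebraMap R K Q)
  unfold quotDeriv
  generalize IsFractionRing.num R (algebraMap R K P / algebraMap R K Q) = P' at *
  generalize IsFractionRing.den R (algebraMap R K P / algebraMap R K Q) = Q₀ at *
  obtain ⟨Q', hQ'⟩ := Q₀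
  replace hQ' : Q' ≠ 0 := nonZeroDivisors.ne_zero hQ'
  have hQK : algebraMap R K Q ≠ 0 := (map_ne_zero_iff _ inj).2 hQ
  have hQK' : algebraMap R K Q' ≠ 0 := (map_ne_zero_iff _ inj).2 hQ'
  simp only at *
  rw [div_eq_div_iff hQK' hQK, ← map_mul, ← map_mul] at h1
  have h2 := congrArg (algebraMap R K) (congrArg D (inj h1))
  replace h1 := congrArg (algebraMap R K) (inj h1)
  simp only [Derivation.leibniz, smul_eq_mul, map_add, map_mul] at h1 h2
  rw [div_eq_div_iff (pow_ne_zero 2 hQK') (pow_ne_zero 2 hQK)]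
  linear_combination algebraMap R K Q * algebraMap R K Q' * h2 -
    (algebraMap R K Q * algebraMap R K (D Q') + algebraMap R K Q' * algebraMap R K (D Q)) * h1

variable [Algebra F K] [IsScalarTower F R K]

/-- The extension of a derivation of `R` to the fraction field. -/
def fracDeriv (D : Derivation F R R) : Derivation F K K :=
  Derivation.mk'
    { toFun := quotDeriv D
      map_add' := fun y z => by
        obtain ⟨P, Q, hQ, rfl⟩ := IsFractionRing.div_surjective R y
        obtain ⟨S, T, hT, rfl⟩ := IsFractionRing.div_surjective R z
        replace hQ := nonZeroDivisors.ne_zero hQ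
        replace hT := nonZeroDivisors.ne_zero hT
        have hQK : algebraMap R K Q ≠ 0 := (map_ne_zero_iff _ (IsFractionRing.injective R K)).2 hQ
        have hTK : algebraMap R K T ≠ 0 := (map_ne_zero_iff _ (IsFractionRing.injective R K)).2 hT
        rw [div_add_div _ _ hQK hTK, ← map_mul, ← map_mul, ← map_mul, ← map_add,
          quotDeriv_div D _ _ (mul_ne_zero hQ hT), quotDeriv_div D _ _ hQ, quotDeriv_div D _ _ hT]
        simp only [Derivation.leibniz, smul_eq_mul, map_add, map_mul]
        field_simp
        ring
      map_smul' := fun c y => by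
        obtain ⟨P, Q, hQ, rfl⟩ := IsFractionRing.div_surjective R y
        replace hQ := nonZeroDivisors.ne_zero hQ
        have e : c • (algebraMap R K P / algebraMap R K Q)
            = algebraMap R K (c • P) / algebraMap R K Q := by
          rw [Algebra.smul_def, Algebra.smul_def, map_mul, mul_div_assoc,
            ← IsScalarTower.algebraMap_apply]
        rw [e, quotDeriv_div D _ _ hQ, quotDeriv_div D _ _ hQ, Derivation.map_smul]
        simp only [Algebra.smul_def, map_mul, ← IsScalarTower.algebraMap_apply, RingHom.id_apply]
        ring }
    (fun y z => by
      obtain ⟨P, Q, hQ, rfl⟩ := IsFractionRing.div_surjective R y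
      obtain ⟨S, T, hT, rfl⟩ := IsFractionRing.div_surjective R z
      replace hQ := nonZeroDivisors.ne_zero hQ
      replace hT := nonZeroDivisors.ne_zero hT
      have hQK : algebraMap R K Q ≠ 0 := (map_ne_zero_iff _ (IsFractionRing.injective R K)).2 hQ
      have hTK : algebraMap R K T ≠ 0 := (map_ne_zero_iff _ (IsFractionRing.injective R K)).2 hT
      simp only [LinearMap.coe_mk, AddHom.coe_mk]
      rw [div_mul_div_comm, ← map_mul, ← map_mul,
        quotDeriv_div D _ _ (mul_ne_zero hQ hT), quotDeriv_div D _ _ hQ, quotDeriv_div D _ _ hT]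
      simp only [Derivation.leibniz, smul_eq_mul, map_add, map_mul]
      field_simp
      ring)

/-- The quotient rule for the extended derivation. -/
theorem fracDeriv_div (D : Derivation F R R) (P Q : R) (hQ : Q ≠ 0) :
    fracDeriv D (algebraMap R K P / algebraMap R K Q) =
      (algebraMap R K (D P) * algebraMap R K Q - algebraMap R K P * algebraMap R K (D Q)) /
        algebraMap R K Q ^ 2 :=
  quotDeriv_div D P Q hQ

end FractionField

/-- The derivation `∂/∂x_j` of the field of rational functions. -/
def partialD {r : ℕ} (j : Fin r) : Derivation ℂ (RatFun r) (RatFun r) :=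
  fracDeriv (MvPolynomial.pderiv j)

/-- The operator `∏_j (∂/∂x_j)^{u_j}`, where `u ∈ ℕ^r`. -/
def iterD {r : ℕ} (u : Fin r → ℕ) : Module.End ℂ (RatFun r) :=
  (List.ofFn fun j => (partialD j : RatFun r →ₗ[ℂ] RatFun r) ^ u j).prod

/-- The toric operator `𝒟_v = ∏_{v_j > 0} (∂/∂x_j)^{v_j} - ∏_{v_j < 0} (∂/∂x_j)^{-v_j}`. -/
def toricOp {r : ℕ} (v : Fin r → ℤ) : Module.End ℂ (RatFun r) :=
  iterD (fun j => (v j).toNat) - iterD (fun j => (-v j).toNat)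

/-- `φ` is a rational solution of the `A`-hypergeometric system with exponent `α`. -/
structure IsRationalSolution {n r : ℕ} (A : Matrix (Fin n) (Fin r) ℤ) (α : Fin n → ℂ)
    (φ : RatFun r) : Prop where
  toric : ∀ v : Fin r → ℤ, A.mulVec v = 0 → toricOp v φ = 0
  euler : ∀ i : Fin n, ∑ j : Fin r, A i j • (var j * partialD j φ) = α i • φ

/-- Laurent polynomials: the linear combinations of the Laurent monomials `∏_j x_j^{n_j}`
with `n ∈ ℤ^r`. -/
def laurentPolynomials (r : ℕ) : Submodule ℂ (RatFun r) :=
  Submodule.span ℂ (Set.range fun n : Fin r → ℤ => ∏ j, var j ^ n j)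

/-- The semigroup `A · ℕ^r`. -/
def expSemigroup {n r : ℕ} (A : Matrix (Fin n) (Fin r) ℤ) : Set (Fin n → ℤ) :=
  {α | ∃ u : Fin r → ℕ, A.mulVec (fun j => (u j : ℤ)) = α}

/-- The hypergeometric polynomial `Φ^A(α; x) = ∑_{u ∈ ℕ^r, A·u = α} x^u / u!`. -/
def hypPoly {n r : ℕ} (A : Matrix (Fin n) (Fin r) ℤ) (α : Fin n → ℤ) : MvPolynomial (Fin r) ℂ :=
  ∑ᶠ (u : Fin r →₀ ℕ) (_ : A.mulVec (fun j => (u j : ℤ)) = α),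
    MvPolynomial.monomial u ((∏ j, ((u j).factorial : ℂ))⁻¹)

/-- `Ψ^A_d(α; x) = ∑_{s ≥ 1} (-1)^s (s-1)! Φ^B(α + s a_d; x') / x_d^s`, where `a_d` is the last
column of `A`, the matrix `B` is `A` without its last column, and `x'` is `x` without its last
variable `x_d`. -/
def psiLast {n r : ℕ} (A : Matrix (Fin n) (Fin (r + 1)) ℤ) (α : Fin n → ℤ) : RatFun (r + 1) :=
  ∑ᶠ (s : ℕ) (_ : 1 ≤ s), ((-1) ^ s * ((s - 1).factorial : ℂ)) •
    (ofPoly (MvPolynomial.rename Fin.castSucc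
      (hypPoly (A.submatrix id Fin.castSucc) (α + (s : ℤ) • fun i => A i (Fin.last r))))
      / var (Fin.last r) ^ s)

/-- `Ψ^A_0(α; x) = ∑_{s ≥ 1} (-1)^s (s-1)! Φ^C(α + s a_0; x̃) / x_0^s`, where `a_0` is the first
column of `A`, the matrix `C` is `A` without its first column, and `x̃` is `x` without its first
variable `x_0`. -/
def psiZero {n r : ℕ} (A : Matrix (Fin n) (Fin (r + 1)) ℤ) (α : Fin n → ℤ) : RatFun (r + 1) :=
  ∑ᶠ (s : ℕ) (_ : 1 ≤ s), ((-1) ^ s * ((s - 1).factorial : ℂ)) •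
    (ofPoly (MvPolynomial.rename Fin.succ
      (hypPoly (A.submatrix id Fin.succ) (α + (s : ℤ) • fun i => A i 0)))
      / var (0 : Fin (r + 1)) ^ s)

/-- The `2 × r` matrix with first row `(1, …, 1)` and second row `(k_1, …, k_r)`. -/
def curveMatrix {r : ℕ} (k : Fin r → ℕ) : Matrix (Fin 2) (Fin r) ℤ :=
  Matrix.of ![fun _ => 1, fun j => (k j : ℤ)]

/-- The generic polynomial `f(x; t) = ∑_j x_j t^{k_j}`, a polynomial in `t` over `ℂ[x]`. -/
def genericPoly {r : ℕ} (k : Fin r → ℕ) : Polynomial (MvPolynomial (Fin r) ℂ) :=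
  ∑ j, Polynomial.monomial (k j) (MvPolynomial.X j)

/-- For `curveMatrix` the sum defining `hypPoly` is finite. -/
theorem hypPoly_finite {r : ℕ} (k : Fin r → ℕ) (α : Fin 2 → ℤ) :
    {u : Fin r →₀ ℕ | (curveMatrix k).mulVec (fun j => (u j : ℤ)) = α}.Finite := by
  refine (Finset.finite_toSet ((Finset.univ : Finset (Fin r)).finsuppAntidiag
    (α 0).toNat)).subset ?_
  intro u hu
  have h := congrFun hu 0
  simp only [curveMatrix, Matrix.mulVec, dotProduct, Matrix.of_apply, Matrix.cons_val_zero,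
    one_mul] at h
  rw [Finset.mem_coe, Finset.mem_finsuppAntidiag]
  refine ⟨?_, Finset.subset_univ _⟩
  rw [← h, ← Nat.cast_sum, Int.toNat_natCast]

/-- `Φ^A(α; x) ≠ 0` only if `α ∈ A · ℕ^r`. -/
theorem mem_of_hypPoly_ne_zero {n r : ℕ} {A : Matrix (Fin n) (Fin r) ℤ} {α : Fin n → ℤ}
    (h : hypPoly A α ≠ 0) : α ∈ expSemigroup A := by
  by_contra hα
  refine h (finsum_eq_zero_of_forall_eq_zero fun u => ?_)
  have : ¬ A.mulVec (fun j => (u j : ℤ)) = α := fun e => hα ⟨u, e⟩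
  simp [this]

/-- The sum defining `psiLast` is finite. -/
theorem psiLast_finite {r : ℕ} (k : Fin (r + 1) → ℕ) (hk : StrictMono k) (α : Fin 2 → ℤ) :
    {s : ℕ | hypPoly ((curveMatrix k).submatrix id Fin.castSucc)
      (α + (s : ℤ) • fun i => curveMatrix k i (Fin.last r)) ≠ 0}.Finite := by
  refine (Set.finite_Iic ((k (Fin.last r) : ℤ) * α 0 - α 1 - α 0).toNat).subset ?_
  intro s hs
  obtain ⟨u, hu⟩ := mem_of_hypPoly_ne_zero hs
  have h0 := congrFun hu 0
  have h1 := congrFun hu 1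
  simp only [curveMatrix, Matrix.mulVec, dotProduct, Matrix.of_apply, Matrix.cons_val_zero,
    Matrix.submatrix_apply, id, Matrix.cons_val_one, Pi.add_apply, Pi.smul_apply, smul_eq_mul,
    one_mul, mul_one] at h0 h1
  have h2 : ∑ j : Fin r, ((k j.castSucc : ℤ) + 1) * (u j : ℤ)
      ≤ ∑ j : Fin r, (k (Fin.last r) : ℤ) * (u j : ℤ) := by
    refine Finset.sum_le_sum fun j _ => mul_le_mul_of_nonneg_right ?_ (by positivity)
    have := hk (Fin.castSucc_lt_last j)
    omega
  rw [← Finset.mul_sum] at h2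
  simp only [add_mul, Finset.sum_add_distrib, one_mul] at h2
  rw [h0, h1, mul_add] at h2
  rw [Set.mem_Iic]
  have h3 : (k (Fin.last r) : ℤ) * s = s * k (Fin.last r) := mul_comm _ _
  omega

/-- The sum defining `psiZero` is finite. -/
theorem psiZero_finite {r : ℕ} (k : Fin (r + 1) → ℕ) (hk : StrictMono k) (h0 : k 0 = 0)
    (α : Fin 2 → ℤ) :
    {s : ℕ | hypPoly ((curveMatrix k).submatrix id Fin.succ)
      (α + (s : ℤ) • fun i => curveMatrix k i 0) ≠ 0}.Finite := by
  refine (Set.finite_Iic (α 1 - α 0).toNat).subset ?_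
  intro s hs
  obtain ⟨u, hu⟩ := mem_of_hypPoly_ne_zero hs
  have h1 := congrFun hu 0
  have h2 := congrFun hu 1
  simp only [curveMatrix, Matrix.mulVec, dotProduct, Matrix.of_apply, Matrix.cons_val_zero,
    Matrix.submatrix_apply, id, Matrix.cons_val_one, Pi.add_apply, Pi.smul_apply, smul_eq_mul,
    one_mul, mul_one, h0, Nat.cast_zero, mul_zero, add_zero] at h1 h2
  have h3 : ∑ j : Fin r, (u j : ℤ) ≤ ∑ j : Fin r, (k j.succ : ℤ) * (u j : ℤ) := by
    refine Finset.sum_le_sum fun j _ => le_mul_of_one_le_left (by positivity) ?_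
    have := hk (Fin.succ_pos j)
    omega
  rw [h1, h2] at h3
  rw [Set.mem_Iic]
  omega

end GKZ

end

/-! ### Expansion of rational functions as Hahn series. -/

noncomputable section

namespace GKZ

open MvPolynomial HahnSeries

/-! Embed the rational functions into a field of Hahn series with support in `ℤ^r`, so that a
function is determined by its Laurent coefficients. The Euler equations say that all exponents `u`
of a solution satisfy `A u = α`. The toric equations link the coefficients at any two such exponents
(`IsRationalSolution.expCoeff_mul`): on exponents with the same negative support they are
proportional to `∏ γ(u_j)`, where `γ` is `invFact`, and they vanish at `u` if some exponent of the
fibre `A u = α` has strictly smaller negative support. Conversely, a minimal negative support gives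
a solution once its series is known to be rational.

For a curve only the supports `∅`, `{0}`, `{d}` survive. A negative exponent at a middle variable
would propagate along a relation among three columns of `A` to an infinite descending chain in the
support of the series (`IsRationalSolution.negSupp_subset`).

The support `{0, d}` does give a formal series, and it is excluded by arithmetic. A rational
function whose expansion has rational coefficients has them `p`-integral for almost all `p`
(`exists_padicNorm_expCoeff_le_one`), in the manner of Eisenstein's theorem, whereas `∏ γ(u_j)`
acquires a denominator `p` for arbitrarily large `p` (`exists_one_lt_padicNorm_invFactProd`).

The remaining three classes are the coefficients of `Φ`, `Ψ_0` and `Ψ_d`. If `α` lies in the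
semigroup, the support `∅` occurs and kills the others; if not, `{0}` and `{d}` are minimal. -/

/-- Exponent vectors in `ℤ^r` with the lexicographic order. -/
abbrev LexExp (r : ℕ) : Type := Lex (Fin r → ℤ)

/-- The Hahn series in `x₁⁻¹, …, x_r⁻¹`; the monomial `x^u` is placed in degree `-u`. -/
abbrev ExpSeries (r : ℕ) : Type := HahnSeries (LexExp r) ℂ

/-- The degree in which the monomial `x^u` is placed. -/
def expDeg {r : ℕ} (u : Fin r → ℤ) : LexExp r := toLex (-u)

theorem expDeg_add {r : ℕ} (u v : Fin r → ℤ) : expDeg (u + v) = expDeg u + expDeg v := by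
  simp only [expDeg, neg_add, toLex_add]

theorem expDeg_sub {r : ℕ} (u v : Fin r → ℤ) : expDeg (u - v) = expDeg u - expDeg v := by
  rw [eq_sub_iff_add_eq, ← expDeg_add, sub_add_cancel]

theorem expDeg_zero {r : ℕ} : expDeg (0 : Fin r → ℤ) = 0 := by
  simp [expDeg]

theorem expDeg_injective {r : ℕ} : Function.Injective (expDeg : (Fin r → ℤ) → LexExp r) :=
  fun _ _ h => neg_injective (toLex.injective h)

theorem expDeg_surjective {r : ℕ} : Function.Surjective (expDeg : (Fin r → ℤ) → LexExp r) :=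
  fun a => ⟨-ofLex a, by simp [expDeg]⟩

/-- The exponent vector of a monomial of a polynomial, as an integer vector. -/
def intExp {r : ℕ} (n : Fin r →₀ ℕ) : Fin r → ℤ := fun j => (n j : ℤ)

theorem intExp_injective {r : ℕ} : Function.Injective (intExp : (Fin r →₀ ℕ) → Fin r → ℤ) :=
  fun _ _ h => Finsupp.ext fun j => Int.ofNat_injective (congrFun h j)

/-- The expansion of polynomials as Hahn series. -/
def polyExpand (r : ℕ) : MvPolynomial (Fin r) ℂ →ₐ[ℂ] ExpSeries r :=
  aeval fun j => single (expDeg (Pi.single j 1)) 1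

theorem polyExpand_monomial {r : ℕ} (n : Fin r →₀ ℕ) (c : ℂ) :
    polyExpand r (monomial n c) = single (expDeg (intExp n)) c := by
  have key : ∀ s : Finset (Fin r),
      (∏ j ∈ s, (single (expDeg (Pi.single j 1)) (1 : ℂ) : ExpSeries r) ^ n j)
        = single (expDeg (∑ j ∈ s, (n j) • (Pi.single j 1 : Fin r → ℤ))) 1 := by
    intro s
    induction s using Finset.induction_on with
    | empty => simp [expDeg_zero]
    | insert a s ha ih =>
      rw [Finset.prod_insert ha, ih, single_pow, single_mul_single, Finset.sum_insert ha,
        expDeg_add, one_pow, one_mul]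
      congr 3
      simp [expDeg]
  rw [polyExpand, aeval_monomial, Finsupp.prod_fintype _ _ (by simp), key,
    HahnSeries.algebraMap_apply, HahnSeries.C_apply, single_mul_single, zero_add]
  simp only [Algebra.algebraMap_self, RingHom.id_apply, mul_one]
  have h : (∑ j, (n j) • (Pi.single j 1 : Fin r → ℤ)) = intExp n := by
    funext i
    simp [intExp, Finset.sum_apply, Pi.single_apply]
  rw [h]

theorem polyExpand_eq_sum {r : ℕ} (P : MvPolynomial (Fin r) ℂ) :
    polyExpand r P = ∑ n ∈ P.support, single (expDeg (intExp n)) (P.coeff n) := by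
  conv_lhs => rw [P.as_sum, map_sum]
  exact Finset.sum_congr rfl fun n _ => polyExpand_monomial n _

theorem coeff_polyExpand {r : ℕ} (P : MvPolynomial (Fin r) ℂ) (n : Fin r →₀ ℕ) :
    (polyExpand r P).coeff (expDeg (intExp n)) = P.coeff n := by
  rw [polyExpand_eq_sum, HahnSeries.coeff_sum]
  simp only [coeff_single, expDeg_injective.eq_iff, intExp_injective.eq_iff]
  simp only [Finset.sum_ite_eq, mem_support_iff, ite_not]
  split_ifs with h
  · exact h.symm
  · rfl

theorem coeff_polyExpand_eq_zero {r : ℕ} (P : MvPolynomial (Fin r) ℂ) {u : Fin r → ℤ}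
    (hu : ∀ n : Fin r →₀ ℕ, intExp n = u → P.coeff n = 0) :
    (polyExpand r P).coeff (expDeg u) = 0 := by
  rw [polyExpand_eq_sum, HahnSeries.coeff_sum]
  refine Finset.sum_eq_zero fun n _ => ?_
  rw [coeff_single]
  split_ifs with h
  · exact hu n (expDeg_injective h).symm
  · rfl

theorem polyExpand_injective (r : ℕ) : Function.Injective (polyExpand r) := by
  rw [injective_iff_map_eq_zero]
  intro P hP
  ext n
  rw [← coeff_polyExpand, hP]
  simp

/-- The expansion of rational functions as Hahn series. -/
def expand (r : ℕ) : RatFun r →ₐ[ℂ] ExpSeries r :=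
  IsFractionRing.liftAlgHom (polyExpand_injective r)

theorem expand_ofPoly {r : ℕ} (P : MvPolynomial (Fin r) ℂ) :
    expand r (ofPoly P) = polyExpand r P := by
  rw [expand, IsFractionRing.liftAlgHom_apply, IsFractionRing.lift_algebraMap]
  rfl

/-- The coefficient of `x^u` in the expansion of a rational function. -/
def expCoeff {r : ℕ} (u : Fin r → ℤ) : RatFun r →ₗ[ℂ] ℂ :=
  (HahnSeries.coeff.linearMap (expDeg u)) ∘ₗ (expand r).toLinearMap

theorem expCoeff_apply {r : ℕ} (u : Fin r → ℤ) (φ : RatFun r) :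
    expCoeff u φ = (expand r φ).coeff (expDeg u) := rfl

/-- The expansion is a ring homomorphism from a field, hence injective. This reduces every identity
between rational functions below to a comparison of coefficients. -/
theorem expCoeff_ext {r : ℕ} {φ ψ : RatFun r} (h : ∀ u, expCoeff u φ = expCoeff u ψ) :
    φ = ψ := by
  refine (expand r).toRingHom.injective (HahnSeries.ext (funext fun a => ?_))
  obtain ⟨u, rfl⟩ := expDeg_surjective a
  exact h u

theorem expCoeff_ofPoly {r : ℕ} (P : MvPolynomial (Fin r) ℂ) (n : Fin r →₀ ℕ) :
    expCoeff (intExp n) (ofPoly P) = P.coeff n := by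
  rw [expCoeff_apply, expand_ofPoly, coeff_polyExpand]

theorem expCoeff_ofPoly_eq_zero {r : ℕ} (P : MvPolynomial (Fin r) ℂ) {u : Fin r → ℤ}
    (hu : ∀ n : Fin r →₀ ℕ, intExp n = u → P.coeff n = 0) : expCoeff u (ofPoly P) = 0 := by
  rw [expCoeff_apply, expand_ofPoly, coeff_polyExpand_eq_zero P hu]

theorem expand_var {r : ℕ} (j : Fin r) :
    expand r (var j) = single (expDeg (Pi.single j 1)) 1 := by
  rw [expand_ofPoly, polyExpand, aeval_X]

theorem expCoeff_var_mul {r : ℕ} (j : Fin r) (φ : RatFun r) (u : Fin r → ℤ) :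
    expCoeff u (var j * φ) = expCoeff (u - Pi.single j 1) φ := by
  rw [expCoeff_apply, map_mul, expand_var, coeff_single_mul, one_mul, expCoeff_apply, expDeg_sub]

theorem expCoeff_div_var_pow {r : ℕ} (j : Fin r) (s : ℕ) (φ : RatFun r) (u : Fin r → ℤ) :
    expCoeff u (φ / var j ^ s) = expCoeff (u + (s : ℤ) • Pi.single j 1) φ := by
  induction s generalizing u with
  | zero => simp
  | succ s ih =>
    have hv : (var j : RatFun r) ≠ 0 :=
      (map_ne_zero_iff _ (IsFractionRing.injective _ _)).2 (X_ne_zero j)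
    have h : φ / var j ^ s = var j * (φ / var j ^ (s + 1)) := by
      field_simp
      ring
    have h2 := ih (u + Pi.single j 1)
    rw [h, expCoeff_var_mul, add_sub_cancel_right] at h2
    rw [h2]
    congr 2
    push_cast
    rw [add_smul, one_smul, add_assoc, add_comm (Pi.single j 1)]

/-- The Euler derivation `x_j ∂/∂x_j` of Hahn series. -/
def eulerSeries {r : ℕ} (j : Fin r) (f : ExpSeries r) : ExpSeries r where
  coeff a := (-(ofLex a j) : ℤ) * f.coeff a
  isPWO_support' := f.isPWO_support.mono fun a ha => by
    rw [Function.mem_support] at ha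
    exact right_ne_zero_of_mul ha

theorem coeff_eulerSeries {r : ℕ} (j : Fin r) (f : ExpSeries r) (u : Fin r → ℤ) :
    (eulerSeries j f).coeff (expDeg u) = (u j : ℂ) * f.coeff (expDeg u) := by
  change (-(-u j) : ℤ) * f.coeff (expDeg u) = _
  rw [neg_neg]

theorem support_eulerSeries {r : ℕ} (j : Fin r) (f : ExpSeries r) :
    (eulerSeries j f).support ⊆ f.support := fun _ ha => right_ne_zero_of_mul ha

theorem eulerSeries_mul {r : ℕ} (j : Fin r) (f g : ExpSeries r) :
    eulerSeries j (f * g) = eulerSeries j f * g + f * eulerSeries j g := by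
  ext a
  -- Both sums are taken over the pairs from the supports of `f` and `g`, not the smaller supports
  -- of the derivatives, so that all three sums compare term by term.
  rw [HahnSeries.coeff_add, coeff_mul_left' f.isPWO_support (support_eulerSeries j f),
    coeff_mul_right' g.isPWO_support (support_eulerSeries j g), ← Finset.sum_add_distrib]
  change (-(ofLex a j) : ℤ) * (f * g).coeff a = _
  rw [HahnSeries.coeff_mul, Finset.mul_sum]
  refine Finset.sum_congr rfl fun b hb => ?_
  have h : a j = b.1 j + b.2 j := by
    rw [← (Finset.mem_antidiagonal.1 hb).2.2]; rfl
  change (-(a j) : ℤ) * (f.coeff b.1 * g.coeff b.2) =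
    (-(b.1 j) : ℤ) * f.coeff b.1 * g.coeff b.2 + f.coeff b.1 * ((-(b.2 j) : ℤ) * g.coeff b.2)
  rw [h]
  push_cast
  ring

theorem eulerSeries_polyExpand {r : ℕ} (j : Fin r) (P : MvPolynomial (Fin r) ℂ) :
    eulerSeries j (polyExpand r P) = polyExpand r (X j * pderiv j P) := by
  induction P using MvPolynomial.induction_on' with
  | monomial n c =>
    have h : (X j : MvPolynomial (Fin r) ℂ) * pderiv j (monomial n c) = monomial n (c * n j) := by
      rw [X_mul_pderiv_monomial, smul_monomial, nsmul_eq_mul, mul_comm]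
    rw [h, polyExpand_monomial, polyExpand_monomial]
    ext a
    obtain ⟨u, rfl⟩ := expDeg_surjective a
    rw [coeff_eulerSeries, coeff_single, coeff_single]
    split_ifs with h
    · rw [expDeg_injective h, mul_comm]
      simp [intExp]
    · simp
  | add p q hp hq =>
    rw [map_add, map_add, mul_add, map_add, ← hp, ← hq]
    ext a
    simp [eulerSeries, mul_add]

theorem partialD_ofPoly {r : ℕ} (j : Fin r) (P : MvPolynomial (Fin r) ℂ) :
    partialD j (ofPoly P) = ofPoly (pderiv j P) := by
  have h := fracDeriv_div (K := RatFun r) (pderiv (R := ℂ) j) P 1 one_ne_zero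
  rw [map_one, div_one, Derivation.map_one_eq_zero, map_zero, mul_zero, sub_zero, mul_one, one_pow,
    div_one] at h
  exact h

/-- Both sides obey the product rule and agree on polynomials. Applying them to `φ * Q = P` and
cancelling `Q` gives agreement on fractions. -/
theorem expand_var_mul_partialD {r : ℕ} (j : Fin r) (φ : RatFun r) :
    expand r (var j * partialD j φ) = eulerSeries j (expand r φ) := by
  obtain ⟨P, Q, hQ, rfl⟩ := IsFractionRing.div_surjective (MvPolynomial (Fin r) ℂ) φ
  replace hQ := nonZeroDivisors.ne_zero hQ
  have hQK : (ofPoly Q : RatFun r) ≠ 0 :=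
    (map_ne_zero_iff _ (IsFractionRing.injective _ _)).2 hQ
  set φ : RatFun r := ofPoly P / ofPoly Q with hφ
  have h0 : φ * ofPoly Q = ofPoly P := div_mul_cancel₀ _ hQK
  have h1 := congrArg (fun y => expand r (var j * partialD j y)) h0
  have h2 := congrArg (fun y => eulerSeries j (expand r y)) h0
  simp only [Derivation.leibniz, smul_eq_mul, partialD_ofPoly] at h1
  simp only [map_mul, eulerSeries_mul, expand_ofPoly, eulerSeries_polyExpand] at h2
  simp only [mul_add, map_add, map_mul (expand r), expand_ofPoly] at h1
  have h3 : polyExpand r Q ≠ 0 := (map_ne_zero_iff _ (polyExpand_injective r)).2 hQ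
  rw [map_mul, expand_ofPoly]
  refine mul_right_cancel₀ h3 ?_
  linear_combination h1 - h2

theorem expCoeff_var_mul_partialD {r : ℕ} (j : Fin r) (φ : RatFun r) (u : Fin r → ℤ) :
    expCoeff u (var j * partialD j φ) = (u j : ℂ) * expCoeff u φ := by
  rw [expCoeff_apply, expand_var_mul_partialD, coeff_eulerSeries, expCoeff_apply]

theorem expCoeff_partialD {r : ℕ} (j : Fin r) (φ : RatFun r) (u : Fin r → ℤ) :
    expCoeff u (partialD j φ) = ((u j : ℂ) + 1) * expCoeff (u + Pi.single j 1) φ := by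
  have h := expCoeff_var_mul_partialD j φ (u + Pi.single j 1)
  rw [expCoeff_var_mul, add_sub_cancel_right] at h
  simpa using h

/-- The rising factorial `(n + 1)(n + 2) ⋯ (n + a)`. -/
def rising (n : ℤ) (a : ℕ) : ℂ := ∏ i ∈ Finset.range a, ((n : ℂ) + 1 + i)

theorem expCoeff_partialD_pow {r : ℕ} (j : Fin r) (a : ℕ) (φ : RatFun r) (u : Fin r → ℤ) :
    expCoeff u (((partialD j : RatFun r →ₗ[ℂ] RatFun r) ^ a) φ) =
      rising (u j) a * expCoeff (u + Pi.single j (a : ℤ)) φ := by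
  induction a generalizing u with
  | zero => simp [rising]
  | succ a ih =>
    rw [pow_succ', Module.End.mul_apply]
    have h := expCoeff_partialD j (((partialD j : RatFun r →ₗ[ℂ] RatFun r) ^ a) φ) u
    refine h.trans ?_
    -- Splitting off the factor `i = 0` leaves the rising factorial that starts at `u j + 1`.
    rw [ih, rising, rising, Finset.prod_range_succ', add_assoc, ← Pi.single_add, ← mul_assoc]
    push_cast
    rw [add_comm (1 : ℤ)]
    congr 1
    simp only [Pi.add_apply, Pi.single_eq_same]
    push_cast
    rw [mul_comm, add_zero]
    congr 1
    exact Finset.prod_congr rfl fun i _ => by ring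

theorem expCoeff_prod_partialD_pow {r : ℕ} (w : Fin r → ℕ) (φ : RatFun r) (l : List (Fin r))
    (hl : l.Nodup) (u : Fin r → ℤ) :
    expCoeff u ((l.map fun j => (partialD j : RatFun r →ₗ[ℂ] RatFun r) ^ w j).prod φ) =
      (l.map fun j => rising (u j) (w j)).prod *
        expCoeff (u + (l.map fun j => (Pi.single j (w j : ℤ) : Fin r → ℤ)).sum) φ := by
  induction l generalizing u with
  | nil => simp
  | cons a l ih =>
    rw [List.nodup_cons] at hl
    simp only [List.map_cons, List.prod_cons, List.sum_cons, Module.End.mul_apply]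
    rw [expCoeff_partialD_pow, ih hl.2, ← mul_assoc, add_assoc]
    congr 3
    refine List.map_congr_left fun j hj => ?_
    -- The shift at `a` does not change the coordinate `u j`; this is where distinctness of the
    -- indices enters.
    have : j ≠ a := fun h => hl.1 (h ▸ hj)
    simp [this]

theorem expCoeff_iterD {r : ℕ} (w : Fin r → ℕ) (φ : RatFun r) (u : Fin r → ℤ) :
    expCoeff u (iterD w φ) =
      (∏ j, rising (u j) (w j)) * expCoeff (u + fun j => (w j : ℤ)) φ := by
  have h := expCoeff_prod_partialD_pow w φ (List.finRange r) (List.nodup_finRange r) u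
  rw [iterD, List.ofFn_eq_map, h, ← List.ofFn_eq_map, ← List.ofFn_eq_map, List.prod_ofFn,
    List.sum_ofFn]
  congr 3
  funext i
  simp [Finset.sum_apply, Pi.single_apply]

end GKZ

end

/-! ### Negative supports and the recurrences for the coefficients. -/

noncomputable section

namespace GKZ

/-- The negative support of an exponent vector. -/
def negSupp {r : ℕ} (u : Fin r → ℤ) : Finset (Fin r) := {j | u j < 0}

theorem mem_negSupp {r : ℕ} {u : Fin r → ℤ} {j : Fin r} : j ∈ negSupp u ↔ u j < 0 := by
  simp [negSupp]

/-- The function with `(n + 1) γ(n + 1) = γ(n)` for `n ≠ -1`, given by `γ(n) = 1 / n!` for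
`n ≥ 0` and `γ(-n-1) = (-1)^(n+1) n!`. -/
def invFact : ℤ → ℚ
  | Int.ofNat n => (n.factorial : ℚ)⁻¹
  | Int.negSucc n => (-1) ^ (n + 1) * n.factorial

theorem invFact_natCast (n : ℕ) : invFact n = (n.factorial : ℚ)⁻¹ := rfl

theorem invFact_negSucc (n : ℕ) : invFact (Int.negSucc n) = (-1) ^ (n + 1) * n.factorial := rfl

theorem invFact_ne_zero (n : ℤ) : invFact n ≠ 0 := by
  rcases n with n | n
  · exact inv_ne_zero (by exact_mod_cast n.factorial_ne_zero)
  · exact mul_ne_zero (pow_ne_zero _ (by norm_num)) (by exact_mod_cast n.factorial_ne_zero)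

theorem succ_mul_invFact (n : ℤ) (hn : n ≠ -1) : ((n : ℚ) + 1) * invFact (n + 1) = invFact n := by
  rcases n with n | n
  · have h : (Int.ofNat n + 1 : ℤ) = ((n + 1 : ℕ) : ℤ) := by push_cast; rfl
    rw [h, invFact_natCast, show invFact (Int.ofNat n) = (n.factorial : ℚ)⁻¹ from rfl,
      Nat.factorial_succ]
    have := n.factorial_ne_zero
    push_cast
    simp only [Int.ofNat_eq_natCast, Int.cast_natCast]
    field_simp
  · rcases n with _ | n
    · exact absurd rfl hn
    · have h : (Int.negSucc (n + 1) + 1 : ℤ) = Int.negSucc n := by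
        rw [Int.negSucc_eq, Int.negSucc_eq]; push_cast; ring
      rw [h, invFact_negSucc, invFact_negSucc, Nat.factorial_succ, Int.negSucc_eq]
      push_cast
      ring

/-- The `a`-th derivative takes `γ(n + a) x^(n + a)` to `γ(n) x^n`, unless the exponent passes from
`0` to `-1` on the way, where a factor of the rising factorial vanishes. -/
theorem rising_mul_invFact (n : ℤ) (a : ℕ) :
    rising n a * (invFact (n + a) : ℂ) =
      if (n + a < 0 ↔ n < 0) then (invFact n : ℂ) else 0 := by
  induction a with
  | zero => simp [rising]
  | succ a ih =>
    rw [rising, Finset.prod_range_succ, ← rising]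
    by_cases h : n + a = -1
    · have h1 : (n : ℂ) + 1 + a = 0 := by
        have : (n : ℂ) + a = -1 := by exact_mod_cast h
        linear_combination this
      rw [h1, mul_zero, zero_mul, if_neg]
      push_cast
      omega
    · have h1 := congrArg (fun x : ℚ => (x : ℂ)) (succ_mul_invFact (n + a) h)
      push_cast at h1
      have h2 : ((n + (a + 1 : ℕ) < 0) ↔ n < 0) ↔ ((n + a < 0) ↔ n < 0) := by
        push_cast
        omega
      simp only [h2]
      rw [← ih, ← h1]
      push_cast
      rw [add_assoc n]
      ring

/-- The product of the values of `invFact` over the coordinates. -/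
def invFactProd {r : ℕ} (u : Fin r → ℤ) : ℚ := ∏ j, invFact (u j)

theorem invFactProd_ne_zero {r : ℕ} (u : Fin r → ℤ) : invFactProd u ≠ 0 :=
  Finset.prod_ne_zero_iff.2 fun _ _ => invFact_ne_zero _

theorem cast_invFactProd_ne_zero {r : ℕ} (u : Fin r → ℤ) : (invFactProd u : ℂ) ≠ 0 :=
  Rat.cast_ne_zero.2 (invFactProd_ne_zero u)

theorem prod_rising_mul_invFactProd {r : ℕ} {w u : Fin r → ℤ} {a : Fin r → ℕ}
    (hu : w + (fun j => (a j : ℤ)) = u) :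
    (∏ j, rising (w j) (a j)) * (invFactProd u : ℂ) =
      if negSupp u = negSupp w then (invFactProd w : ℂ) else 0 := by
  subst hu
  simp only [invFactProd, Rat.cast_prod, ← Finset.prod_mul_distrib, Pi.add_apply,
    rising_mul_invFact]
  rw [Finset.prod_ite_zero]
  simp [Finset.ext_iff, mem_negSupp]

variable {n r : ℕ} {A : Matrix (Fin n) (Fin r) ℤ}

theorem expCoeff_euler (φ : RatFun r) (u : Fin r → ℤ) (i : Fin n) :
    expCoeff u (∑ j, A i j • (var j * partialD j φ)) = (A.mulVec u i : ℂ) * expCoeff u φ := by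
  rw [map_sum, Matrix.mulVec, dotProduct, Int.cast_sum, Finset.sum_mul]
  refine Finset.sum_congr rfl fun j _ => ?_
  rw [map_zsmul, expCoeff_var_mul_partialD, zsmul_eq_mul]
  push_cast
  ring

theorem expCoeff_toricOp (φ : RatFun r) (v w : Fin r → ℤ) :
    expCoeff w (toricOp v φ) =
      (∏ j, rising (w j) (v j).toNat) * expCoeff (w + fun j => ((v j).toNat : ℤ)) φ -
      (∏ j, rising (w j) (-v j).toNat) * expCoeff (w + fun j => ((-v j).toNat : ℤ)) φ := by
  rw [toricOp, LinearMap.sub_apply, map_sub, expCoeff_iterD, expCoeff_iterD]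

theorem IsRationalSolution.mulVec_eq {α : Fin n → ℂ} {φ : RatFun r}
    (h : IsRationalSolution A α φ) {u : Fin r → ℤ} (hu : expCoeff u φ ≠ 0) :
    (fun i => (A.mulVec u i : ℂ)) = α := by
  funext i
  have := congrArg (expCoeff u) (h.euler i)
  rw [expCoeff_euler, map_smul, smul_eq_mul] at this
  exact mul_right_cancel₀ hu this

theorem IsRationalSolution.add {α : Fin n → ℂ} {φ ψ : RatFun r}
    (h : IsRationalSolution A α φ) (h' : IsRationalSolution A α ψ) :
    IsRationalSolution A α (φ + ψ) where
  toric v hv := by rw [map_add, h.toric v hv, h'.toric v hv, add_zero]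
  euler i := by
    rw [smul_add, ← h.euler i, ← h'.euler i, ← Finset.sum_add_distrib]
    simp only [map_add, mul_add, smul_add]

theorem IsRationalSolution.smul {α : Fin n → ℂ} {φ : RatFun r}
    (h : IsRationalSolution A α φ) (c : ℂ) : IsRationalSolution A α (c • φ) where
  toric v hv := by rw [map_smul, h.toric v hv, smul_zero]
  euler i := by
    rw [smul_comm, ← h.euler i, Finset.smul_sum]
    simp only [Derivation.map_smul, mul_smul_comm, smul_comm c]

/-- The coefficients of a solution at two exponents, one with the smaller negative support. -/
theorem IsRationalSolution.expCoeff_mul {α : Fin n → ℂ} {φ : RatFun r}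
    (h : IsRationalSolution A α φ) {u u' : Fin r → ℤ} (hA : A.mulVec u = A.mulVec u')
    (hs : negSupp u ⊆ negSupp u') :
    expCoeff u' φ * invFactProd u =
      if negSupp u = negSupp u' then expCoeff u φ * invFactProd u' else 0 := by
  have hv : A.mulVec (u - u') = 0 := by rw [Matrix.mulVec_sub, hA, sub_self]
  -- The two halves of the operator of `u - u'` take `x^u` and `x^u'` to multiples of the same
  -- monomial `x^(u ⊓ u')`. Its coefficient is therefore a relation between these two exponents
  -- alone.
  have h0 := congrArg (expCoeff (u ⊓ u')) (h.toric _ hv)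
  have e1 : u ⊓ u' + (fun j => (((u - u') j).toNat : ℤ)) = u := by
    funext j
    simp only [Pi.add_apply, Pi.inf_apply, Pi.sub_apply]
    omega
  have e2 : u ⊓ u' + (fun j => ((-(u - u') j).toNat : ℤ)) = u' := by
    funext j
    simp only [Pi.add_apply, Pi.inf_apply, Pi.sub_apply]
    omega
  -- The negative support of the infimum is the union of the two, hence that of `u'`. Descending
  -- from `u'` thus never crosses zero; descending from `u` does so unless the supports agree.
  have hw : negSupp (u ⊓ u') = negSupp u' := by
    ext j
    have := @hs j
    simp only [mem_negSupp, Pi.inf_apply, inf_lt_iff] at this ⊢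
    tauto
  have h1 := prod_rising_mul_invFactProd e1
  have h2 := prod_rising_mul_invFactProd e2
  rw [expCoeff_toricOp, e1, e2, map_zero, sub_eq_zero] at h0
  rw [hw] at h1 h2
  rw [if_pos rfl] at h2
  refine mul_right_cancel₀ (cast_invFactProd_ne_zero (u ⊓ u')) ?_
  split_ifs at h1 ⊢
  · linear_combination (-(invFactProd u : ℂ) * invFactProd u') * h0 +
      (expCoeff u φ * invFactProd u') * h1 - (expCoeff u' φ * invFactProd u) * h2
  · linear_combination (-(invFactProd u : ℂ) * invFactProd u') * h0 +
      (expCoeff u φ * invFactProd u') * h1 - (expCoeff u' φ * invFactProd u) * h2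

/-- The coefficients `∏_j γ(u_j)` on the exponents with `A u = α` and negative support `I`. -/
def classCoeff (A : Matrix (Fin n) (Fin r) ℤ) (α : Fin n → ℤ) (I : Finset (Fin r))
    (u : Fin r → ℤ) : ℂ :=
  open Classical in if A.mulVec u = α ∧ negSupp u = I then (invFactProd u : ℂ) else 0

theorem classCoeff_of_mem {α : Fin n → ℤ} {I : Finset (Fin r)} {u : Fin r → ℤ}
    (h : A.mulVec u = α) (h' : negSupp u = I) : classCoeff A α I u = invFactProd u :=
  if_pos ⟨h, h'⟩

theorem classCoeff_of_notMem {α : Fin n → ℤ} {I : Finset (Fin r)} {u : Fin r → ℤ}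
    (h : ¬ (A.mulVec u = α ∧ negSupp u = I)) : classCoeff A α I u = 0 :=
  if_neg h

/-- The right side depends on `w` only, so the two halves of a toric operator cancel.
Differentiation can only enlarge the negative support; if `w` has support `I`, then minimality of
`I` forces the same support on `u`. -/
theorem prod_rising_mul_classCoeff {α : Fin n → ℤ} {I : Finset (Fin r)}
    {w u : Fin r → ℤ} {a : Fin r → ℕ} (hu : w + (fun j => (a j : ℤ)) = u) (hA : A.mulVec u = α)
    (hI : ∀ u, A.mulVec u = α → negSupp u ⊆ I → negSupp u = I) :
    (∏ j, rising (w j) (a j)) * classCoeff A α I u =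
      if negSupp w = I then (invFactProd w : ℂ) else 0 := by
  have h1 := prod_rising_mul_invFactProd hu
  have hs : negSupp u ⊆ negSupp w := by
    intro j
    rw [mem_negSupp, mem_negSupp, ← hu, Pi.add_apply]
    omega
  by_cases h : negSupp u = I
  · rw [classCoeff_of_mem hA h, h1, h]
    simp only [eq_comm]
  · rw [classCoeff_of_notMem fun h' => h h'.2, mul_zero, if_neg]
    intro h'
    exact h (hI u hA (h' ▸ hs))

/-- The coefficients of a class with minimal negative support define a solution. -/
theorem isRationalSolution_of_expCoeff {α : Fin n → ℤ} {I : Finset (Fin r)} {φ : RatFun r}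
    (hφ : ∀ u, expCoeff u φ = classCoeff A α I u)
    (hI : ∀ u, A.mulVec u = α → negSupp u ⊆ I → negSupp u = I) :
    IsRationalSolution A (fun i => (α i : ℂ)) φ where
  toric v hv := by
    refine expCoeff_ext fun w => ?_
    rw [expCoeff_toricOp, map_zero, hφ, hφ, sub_eq_zero]
    have e : (w + fun j => ((v j).toNat : ℤ)) = (w + fun j => ((-v j).toNat : ℤ)) + v := by
      funext j
      simp only [Pi.add_apply]
      omega
    have e' := congrArg A.mulVec e
    rw [Matrix.mulVec_add _ _ v, hv, add_zero] at e'
    by_cases h : A.mulVec (w + fun j => ((v j).toNat : ℤ)) = α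
    · rw [prod_rising_mul_classCoeff rfl h hI, prod_rising_mul_classCoeff rfl (e' ▸ h) hI]
    · rw [classCoeff_of_notMem fun h' => h h'.1,
        classCoeff_of_notMem fun h' => h (e'.trans h'.1), mul_zero, mul_zero]
  euler i := by
    refine expCoeff_ext fun u => ?_
    rw [expCoeff_euler, map_smul, smul_eq_mul, hφ]
    by_cases h : A.mulVec u = α
    · rw [h]
    · rw [classCoeff_of_notMem fun h' => h h'.1, mul_zero, mul_zero]

end GKZ

end

/-! ### Integrality of expansions, and negative exponents at middle variables. -/

noncomputable section

namespace GKZ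

/-- A nonzero rational number has `p`-adic norm one for all but finitely many primes. -/
theorem exists_padicNorm_eq_one (T : Finset ℚ) :
    ∃ N : ℕ, ∀ p : ℕ, p.Prime → N < p → ∀ x ∈ T, x ≠ 0 → padicNorm p x = 1 := by
  refine ⟨T.sup fun x => max x.num.natAbs x.den, fun p hp hN x hx h0 => ?_⟩
  have := Fact.mk hp
  have h1 : max x.num.natAbs x.den < p :=
    (Finset.le_sup (f := fun x : ℚ => max x.num.natAbs x.den) hx).trans_lt hN
  have h2 : padicNorm p x.num = 1 := by
    rw [padicNorm.int_eq_one_iff]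
    intro h
    have := Nat.le_of_dvd (Int.natAbs_pos.2 (Rat.num_ne_zero.2 h0)) (Int.natCast_dvd.1 h)
    omega
  have h3 : padicNorm p x.den = 1 := by
    rw [padicNorm.nat_eq_one_iff]
    intro h
    have := Nat.le_of_dvd x.pos h
    omega
  conv_lhs => rw [← Rat.num_div_den x]
  rw [padicNorm.div, h2, h3, div_one]

theorem sum_coeff_mul_expCoeff {r : ℕ} (φ : RatFun r) (Q : MvPolynomial (Fin r) ℂ)
    (u : Fin r → ℤ) :
    expCoeff u (ofPoly Q * φ) = ∑ q ∈ Q.support, Q.coeff q * expCoeff (u - intExp q) φ := by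
  rw [expCoeff_apply, map_mul, expand_ofPoly, polyExpand_eq_sum, Finset.sum_mul,
    HahnSeries.coeff_sum]
  refine Finset.sum_congr rfl fun q _ => ?_
  rw [HahnSeries.coeff_single_mul, expCoeff_apply, expDeg_sub]

/-- If the expansion of a rational function has rational coefficients, then they are `p`-integral
for all but finitely many primes `p`. -/
theorem exists_padicNorm_expCoeff_le_one {r : ℕ} {φ : RatFun r} {c : (Fin r → ℤ) → ℚ}
    (hc : ∀ u, expCoeff u φ = c u) :
    ∃ N : ℕ, ∀ p : ℕ, p.Prime → N < p → ∀ u, padicNorm p (c u) ≤ 1 := by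
  classical
  obtain ⟨P, Q, hQ, hφ⟩ := IsFractionRing.div_surjective (MvPolynomial (Fin r) ℂ) φ
  replace hQ := nonZeroDivisors.ne_zero hQ
  have hQK : (ofPoly Q : RatFun r) ≠ 0 :=
    (map_ne_zero_iff _ (IsFractionRing.injective _ _)).2 hQ
  have hPQ : ofPoly Q * φ = ofPoly P := by
    rw [← hφ]; exact mul_div_cancel₀ _ hQK
  -- The exponent of `Q` in lowest degree, that is, its leading term in the expansion.
  obtain ⟨q₀, hq₀, hmin⟩ := Q.support.exists_min_image (fun q => expDeg (intExp q))
    (MvPolynomial.support_nonempty.2 hQ)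
  -- `P` and `Q` have complex coefficients. A `ℚ`-linear functional that is nonzero on the leading
  -- coefficient of `Q` makes them rational, and the rational `c` pass through it.
  obtain ⟨l, hl⟩ : ∃ l : Module.Dual ℚ ℂ, l (Q.coeff q₀) ≠ 0 := by
    by_contra! h
    exact MvPolynomial.mem_support_iff.1 hq₀ ((Module.forall_dual_apply_eq_zero_iff ℚ _).1 h)
  have rel : ∀ u, ∑ q ∈ Q.support, l (Q.coeff q) * c (u - intExp q)
      = l (expCoeff u (ofPoly P)) := by
    intro u
    rw [← hPQ, sum_coeff_mul_expCoeff, map_sum]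
    refine Finset.sum_congr rfl fun q _ => ?_
    rw [hc, mul_comm (Q.coeff q), ← Rat.smul_def, map_smul, smul_eq_mul, mul_comm]
  obtain ⟨N, hN⟩ := exists_padicNorm_eq_one
    (Q.support.image (fun q => l (Q.coeff q)) ∪ P.support.image (fun q => l (P.coeff q)))
  refine ⟨N, fun p hp hNp => ?_⟩
  have := Fact.mk hp
  have le_one : ∀ x ∈ Q.support.image (fun q => l (Q.coeff q)) ∪
      P.support.image (fun q => l (P.coeff q)), padicNorm p x ≤ 1 := by
    intro x hx
    by_cases h0 : x = 0
    · simp [h0]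
    · exact (hN p hp hNp x hx h0).le
  have hQint : ∀ q ∈ Q.support, padicNorm p (l (Q.coeff q)) ≤ 1 := fun q hq =>
    le_one _ (Finset.mem_union_left _ (Finset.mem_image_of_mem _ hq))
  have hPint : ∀ u, padicNorm p (l (expCoeff u (ofPoly P))) ≤ 1 := by
    intro u
    by_cases h : ∃ n : Fin r →₀ ℕ, intExp n = u ∧ P.coeff n ≠ 0
    · obtain ⟨n, rfl, hn⟩ := h
      rw [expCoeff_ofPoly]
      exact le_one _ (Finset.mem_union_right _
        (Finset.mem_image_of_mem _ (MvPolynomial.mem_support_iff.2 hn)))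
    · push Not at h
      rw [expCoeff_ofPoly_eq_zero P h]
      simp
  by_contra! hbad
  -- The degrees with a non-integral coefficient. They lie in the well-founded support of the
  -- series, so a lowest one exists; but the recursion given by `Q * φ = P` expresses that
  -- coefficient, up to a `p`-adic unit, through integral ones in lower degrees.
  let S : Set (LexExp r) := expDeg '' {u | 1 < padicNorm p (c u)}
  have hS : S.IsWF := by
    refine (expand r φ).isWF_support.mono ?_
    rintro _ ⟨u, hu, rfl⟩
    rw [HahnSeries.mem_support, ← expCoeff_apply, hc]
    intro h0
    rw [Rat.cast_eq_zero] at h0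
    rw [Set.mem_ofPred_eq, h0, padicNorm.zero] at hu
    linarith
  have hne : S.Nonempty := hbad.elim fun u hu => ⟨_, u, hu, rfl⟩
  obtain ⟨u, hu, hu'⟩ := hS.min_mem hne
  have h1 := rel (u + intExp q₀)
  rw [← Finset.add_sum_erase _ _ hq₀, add_sub_cancel_right] at h1
  have h2 : padicNorm p (l (Q.coeff q₀) * c u) ≤ 1 := by
    rw [eq_sub_of_add_eq h1]
    refine (padicNorm.sub).trans (max_le (hPint _) ?_)
    refine padicNorm.sum_le' (fun q hq => ?_) zero_le_one
    have hq' := Finset.mem_of_mem_erase hq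
    rw [padicNorm.mul]
    refine mul_le_one₀ (hQint q hq') (padicNorm.nonneg _) ?_
    by_contra! hlt
    refine hS.not_lt_min hne ⟨_, hlt, rfl⟩ ?_
    rw [← hu', expDeg_sub, expDeg_add, sub_lt_iff_lt_add, add_lt_add_iff_left]
    refine lt_of_le_of_ne (hmin q hq') fun h => Finset.ne_of_mem_erase hq ?_
    exact (intExp_injective (expDeg_injective h)).symm
  rw [padicNorm.mul, hN p hp hNp _
    (Finset.mem_union_left _ (Finset.mem_image_of_mem _ hq₀)) hl, one_mul] at h2
  exact absurd hu (not_lt.2 h2)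

/-- The relation `(k_d - k_i) e_0 + k_i e_d - k_d e_i` among the columns of `curveMatrix k`, for
`k_0 = 0` and the last index `d`. -/
def curveRelation {m : ℕ} (k : Fin (m + 2) → ℕ) (i : Fin (m + 2)) : Fin (m + 2) → ℤ :=
  Pi.single 0 ((k (Fin.last _) : ℤ) - k i) + Pi.single (Fin.last _) (k i : ℤ) -
    Pi.single i (k (Fin.last _) : ℤ)

theorem curveMatrix_mulVec_curveRelation {m : ℕ} {k : Fin (m + 2) → ℕ} (hk0 : k 0 = 0)
    (i : Fin (m + 2)) : (curveMatrix k).mulVec (curveRelation k i) = 0 := by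
  rw [curveRelation, Matrix.mulVec_sub, Matrix.mulVec_add]
  funext j
  fin_cases j <;> simp [curveMatrix, hk0, mul_comm]

section

variable {m : ℕ} {k : Fin (m + 2) → ℕ} {i : Fin (m + 2)}

theorem curveRelation_zero (h0 : i ≠ 0) :
    curveRelation k i 0 = (k (Fin.last _) : ℤ) - k i := by
  simp [curveRelation, h0.symm]

theorem curveRelation_last (hl : i ≠ Fin.last _) :
    curveRelation k i (Fin.last _) = k i := by
  simp [curveRelation, hl.symm]

theorem curveRelation_self (h0 : i ≠ 0) (hl : i ≠ Fin.last _) :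
    curveRelation k i i = -(k (Fin.last _) : ℤ) := by
  simp [curveRelation, hl, h0]

theorem curveRelation_of_ne {j : Fin (m + 2)} (h0 : j ≠ 0) (hl : j ≠ Fin.last _) (hj : j ≠ i) :
    curveRelation k i j = 0 := by
  simp [curveRelation, hl, h0, hj]

/-- The first coordinate of the relation is positive and decides the lexicographic order. Placing
`x^u` in degree `-u` makes a shift by the relation go down. -/
theorem expDeg_curveRelation_neg (hk : StrictMono k) (h0 : i ≠ 0) (hl : i ≠ Fin.last _) :
    expDeg (curveRelation k i) < 0 := by
  refine ⟨0, fun j hj => absurd hj (Fin.not_lt_zero j), ?_⟩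
  change -curveRelation k i 0 < 0
  rw [curveRelation_zero h0]
  have := hk (lt_of_le_of_ne (Fin.le_last i) hl)
  omega

/-- The exponents of a rational solution are nonnegative but at the first and last index. -/
theorem IsRationalSolution.negSupp_subset (hk : StrictMono k) (hk0 : k 0 = 0) {α : Fin 2 → ℂ}
    {φ : RatFun (m + 2)} (h : IsRationalSolution (curveMatrix k) α φ) {u : Fin (m + 2) → ℤ}
    (hu : expCoeff u φ ≠ 0) : negSupp u ⊆ {0, Fin.last _} := by
  intro i hi
  by_contra hmid
  rw [Finset.mem_insert, Finset.mem_singleton, not_or] at hmid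
  obtain ⟨h0, hl⟩ := hmid
  rw [mem_negSupp] at hi
  have hd := hk (lt_of_le_of_ne (Fin.le_last i) hl)
  have hp := hk (Fin.pos_iff_ne_zero.2 h0)
  rw [hk0] at hp
  -- The relation is at least `1` at the first and last index and negative only at `i`, where `u` is
  -- negative already. For such `N` the first and last entries are nonnegative, so the negative
  -- support does not grow, and a zero coefficient at the shifted exponent would force a zero
  -- coefficient at `u`.
  have key : ∀ N : ℕ, (u 0).natAbs + (u (Fin.last _)).natAbs ≤ N →
      expCoeff (u + (N : ℤ) • curveRelation k i) φ ≠ 0 := by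
    intro N hN
    have hs : negSupp (u + (N : ℤ) • curveRelation k i) ⊆ negSupp u := by
      intro j hj
      rw [mem_negSupp, Pi.add_apply, Pi.smul_apply, smul_eq_mul] at hj
      rw [mem_negSupp]
      by_cases hj0 : j = 0
      · subst hj0
        rw [curveRelation_zero h0] at hj
        have : (N : ℤ) * 1 ≤ N * ((k (Fin.last _) : ℤ) - k i) :=
          mul_le_mul_of_nonneg_left (by omega) (by omega)
        omega
      by_cases hjl : j = Fin.last _
      · subst hjl
        rw [curveRelation_last hl] at hj
        have : (N : ℤ) * 1 ≤ N * (k i : ℤ) := mul_le_mul_of_nonneg_left (by omega) (by omega)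
        omega
      by_cases hji : j = i
      · rwa [hji]
      · rwa [curveRelation_of_ne hj0 hjl hji, mul_zero, add_zero] at hj
    have h1 := h.expCoeff_mul (by rw [Matrix.mulVec_add, Matrix.mulVec_smul,
      curveMatrix_mulVec_curveRelation hk0, smul_zero, add_zero]) hs
    intro h2
    rw [h2, zero_mul, ite_self, mul_eq_zero] at h1
    exact h1.elim hu (cast_invFactProd_ne_zero _)
  -- These exponents form an infinite descending chain in the support of the expansion.
  let S : Set (LexExp (m + 2)) := (fun N : ℕ => expDeg (u + (N : ℤ) • curveRelation k i)) ''
    {N | (u 0).natAbs + (u (Fin.last _)).natAbs ≤ N}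
  have hS : S.IsWF := by
    refine (expand _ φ).isWF_support.mono ?_
    rintro _ ⟨N, hN, rfl⟩
    exact key N hN
  have hne : S.Nonempty := ⟨_, _, Set.mem_ofPred.2 le_rfl, rfl⟩
  obtain ⟨N, hN, hN'⟩ := hS.min_mem hne
  rw [Set.mem_ofPred_eq] at hN
  refine hS.not_lt_min hne ⟨N + 1, Nat.le_succ_of_le hN, rfl⟩ ?_
  rw [← hN']
  simp only
  push_cast
  rw [add_smul, one_smul, ← add_assoc, expDeg_add _ (curveRelation k i)]
  exact add_lt_of_neg_right _ (expDeg_curveRelation_neg hk h0 hl)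

end

end GKZ

end

/-! ### Excluding the support `{0, d}`; the coefficients of a general solution. -/

noncomputable section

namespace GKZ

/-- For `n ≥ 0` the value is the inverse of an integer. For `-p ≤ n < 0` it is `± (-n - 1)!`, a
product of numbers below `p`. -/
theorem one_le_padicNorm_invFact {p : ℕ} [hp : Fact p.Prime] {n : ℤ} (hn : -(p : ℤ) ≤ n) :
    1 ≤ padicNorm p (invFact n) := by
  rcases n with n | n
  · rw [show invFact (Int.ofNat n) = (1 : ℚ) / n.factorial from (one_div _).symm, padicNorm.div,
      padicNorm.one]
    refine one_le_one_div ?_ (by simpa using padicNorm.of_nat (p := p) n.factorial)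
    exact lt_of_le_of_ne (padicNorm.nonneg _)
      (padicNorm.nonzero (by exact_mod_cast n.factorial_ne_zero)).symm
  · have h : padicNorm p (n.factorial : ℚ) = 1 := by
      rw [padicNorm.nat_eq_one_iff, hp.out.dvd_factorial]
      omega
    rw [invFact_negSucc, padicNorm.mul, h, mul_one]
    rcases neg_one_pow_eq_or ℚ (n + 1) with h | h <;> simp [h]

theorem one_lt_padicNorm_invFact {p : ℕ} [hp : Fact p.Prime] {n : ℤ} (hn : (p : ℤ) ≤ n) :
    1 < padicNorm p (invFact n) := by
  lift n to ℕ using by omega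
  rw [invFact_natCast, ← one_div, padicNorm.div, padicNorm.one]
  refine one_lt_one_div ?_ ?_
  · exact lt_of_le_of_ne (padicNorm.nonneg _)
      (padicNorm.nonzero (by exact_mod_cast n.factorial_ne_zero)).symm
  · rw [padicNorm.nat_lt_one_iff, hp.out.dvd_factorial]
    exact_mod_cast hn

theorem one_lt_padicNorm_invFactProd {r p : ℕ} [hp : Fact p.Prime] {u : Fin r → ℤ} (i : Fin r)
    (hi : (p : ℤ) ≤ u i) (hu : ∀ j, -(p : ℤ) ≤ u j) : 1 < padicNorm p (invFactProd u) := by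
  have hprod : ∀ s : Finset (Fin r), 1 ≤ padicNorm p (∏ j ∈ s, invFact (u j)) := by
    intro s
    induction s using Finset.induction_on with
    | empty => simp
    | insert a s ha ih =>
      rw [Finset.prod_insert ha, padicNorm.mul]
      exact one_le_mul_of_one_le_of_one_le (one_le_padicNorm_invFact (hu a)) ih
  rw [invFactProd, ← Finset.mul_prod_erase _ _ (Finset.mem_univ i), padicNorm.mul]
  exact one_lt_mul_of_lt_of_le (one_lt_padicNorm_invFact hi) (hprod _)

variable {m : ℕ} {k : Fin (m + 2) → ℕ}

/-- The products of factorials on the class of exponents that are negative exactly at the first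
and last index are not `p`-integral for infinitely many primes `p`. -/
theorem exists_one_lt_padicNorm_invFactProd (hk : StrictMono k) (hk0 : k 0 = 0)
    {i : Fin (m + 2)} (h0 : i ≠ 0) (hl : i ≠ Fin.last _) {u : Fin (m + 2) → ℤ}
    (hu : negSupp u = {0, Fin.last _}) (N : ℕ) :
    ∃ p : ℕ, p.Prime ∧ N < p ∧ ∃ u', (curveMatrix k).mulVec u' = (curveMatrix k).mulVec u ∧
      negSupp u' = {0, Fin.last _} ∧ 1 < padicNorm p (invFactProd u') := by
  have hd := hk (lt_of_le_of_ne (Fin.le_last i) hl)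
  have hp := hk (Fin.pos_iff_ne_zero.2 h0)
  rw [hk0] at hp
  have neg_iff : ∀ j, u j < 0 ↔ j = 0 ∨ j = Fin.last _ := fun j => by
    rw [← mem_negSupp, hu, Finset.mem_insert, Finset.mem_singleton]
  have hu0 := (neg_iff 0).2 (Or.inl rfl)
  have hul := (neg_iff (Fin.last _)).2 (Or.inr rfl)
  have hui : 0 ≤ u i := not_lt.1 fun h => ((neg_iff i).1 h).elim h0 hl
  -- This bound makes `p / d`, and with it the shift `s` below, larger than `d + B`.
  obtain ⟨p, hpN, pp⟩ := Nat.exists_infinite_primes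
    (N + 1 + k (Fin.last _) * (k (Fin.last _) + ∑ j, (u j).natAbs))
  have hp' : Fact p.Prime := ⟨pp⟩
  set d := k (Fin.last (m + 1)) with hd_def
  set B := ∑ j, (u j).natAbs with hB
  have hBj : ∀ j, (u j).natAbs ≤ B := fun j =>
    Finset.single_le_sum (f := fun j => (u j).natAbs) (fun _ _ => Nat.zero_le _)
      (Finset.mem_univ j)
  -- The least `s` with `s * d > p`. Subtracting `s` times the relation raises entry `i` above `p`.
  -- The first and last entries drop by `s * (d - k i)` and `s * k i`, both at most `s * d - s ≤ p +
  -- d - s < p - B`, so they stay above `-p`; being lowered, they also stay negative.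
  obtain ⟨s, hs⟩ : ∃ s, s = p / d + 1 := ⟨_, rfl⟩
  have hs1 : p < s * d := by
    rw [hs]; exact (Nat.div_lt_iff_lt_mul (by omega)).1 (Nat.lt_succ_self _)
  have hs2 : s * d ≤ p + d := by
    rw [hs, add_mul, one_mul]; exact Nat.add_le_add_right (Nat.div_mul_le_self _ _) _
  have hs3 : d + B < s := by
    rw [hs, Nat.lt_succ_iff, Nat.le_div_iff_mul_le (by omega), mul_comm]
    omega
  have hs4 : s ≤ s * k i := Nat.le_mul_of_pos_right _ hp
  have hs5 : s + s * k i ≤ s * d := by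
    calc s + s * k i = s * (k i + 1) := by ring
      _ ≤ s * d := Nat.mul_le_mul_left _ hd
  have dB : B ≤ p := by
    have : B ≤ d * (d + B) := (Nat.le_add_left B d).trans (Nat.le_mul_of_pos_left _ (by omega))
    omega
  have val0 : (u - (s : ℤ) • curveRelation k i) 0 = u 0 - (s * d : ℕ) + (s * k i : ℕ) := by
    rw [Pi.sub_apply, Pi.smul_apply, curveRelation_zero h0]; push_cast; rw [smul_eq_mul]; ring
  have vall : (u - (s : ℤ) • curveRelation k i) (Fin.last _) =
      u (Fin.last _) - (s * k i : ℕ) := by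
    rw [Pi.sub_apply, Pi.smul_apply, curveRelation_last hl]; push_cast; rfl
  have vali : (u - (s : ℤ) • curveRelation k i) i = u i + (s * d : ℕ) := by
    rw [Pi.sub_apply, Pi.smul_apply, curveRelation_self h0 hl]; push_cast; rw [smul_eq_mul]; ring
  have valj : ∀ j, j ≠ 0 → j ≠ Fin.last _ → j ≠ i →
      (u - (s : ℤ) • curveRelation k i) j = u j := fun j h1 h2 h3 => by
    rw [Pi.sub_apply, Pi.smul_apply, curveRelation_of_ne h1 h2 h3, smul_zero, sub_zero]
  refine ⟨p, pp, by omega, u - (s : ℤ) • curveRelation k i, ?_, ?_, ?_⟩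
  · rw [Matrix.mulVec_sub, Matrix.mulVec_smul, curveMatrix_mulVec_curveRelation hk0, smul_zero,
      sub_zero]
  · ext j
    rw [← hu, mem_negSupp, mem_negSupp]
    by_cases hj0 : j = 0
    · subst hj0; rw [val0]; omega
    by_cases hjl : j = Fin.last _
    · subst hjl; rw [vall]; omega
    by_cases hji : j = i
    · subst hji; rw [vali]; omega
    · rw [valj j hj0 hjl hji]
  · refine one_lt_padicNorm_invFactProd i (by rw [vali]; omega) fun j => ?_
    have := hBj j
    by_cases hj0 : j = 0
    · subst hj0; rw [val0]; omega
    by_cases hjl : j = Fin.last _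
    · subst hjl; rw [vall]; omega
    by_cases hji : j = i
    · subst hji; rw [vali]; omega
    · rw [valj j hj0 hjl hji]; omega

theorem IsRationalSolution.mulVec_eq_mulVec {n r : ℕ} {A : Matrix (Fin n) (Fin r) ℤ}
    {α : Fin n → ℂ} {φ : RatFun r} (h : IsRationalSolution A α φ) {u u' : Fin r → ℤ}
    (hu : expCoeff u φ ≠ 0) (hu' : expCoeff u' φ ≠ 0) : A.mulVec u = A.mulVec u' := by
  funext i
  exact_mod_cast congrFun ((h.mulVec_eq hu).trans (h.mulVec_eq hu').symm) i

theorem IsRationalSolution.negSupp_subset_of_ne_zero {n r : ℕ} {A : Matrix (Fin n) (Fin r) ℤ}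
    {α : Fin n → ℂ} {φ : RatFun r} (h : IsRationalSolution A α φ) {u u' : Fin r → ℤ}
    (hA : A.mulVec u = A.mulVec u') (hs : negSupp u ⊆ negSupp u') (hu' : expCoeff u' φ ≠ 0) :
    negSupp u = negSupp u' := by
  by_contra hne
  have h1 := h.expCoeff_mul hA hs
  rw [if_neg hne, mul_eq_zero] at h1
  exact h1.elim hu' (cast_invFactProd_ne_zero _)

theorem IsRationalSolution.expCoeff_mul_of_negSupp_eq {n r : ℕ} {A : Matrix (Fin n) (Fin r) ℤ}
    {α : Fin n → ℂ} {φ : RatFun r} (h : IsRationalSolution A α φ) {u u' : Fin r → ℤ}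
    (hA : A.mulVec u = A.mulVec u') (hs : negSupp u = negSupp u') :
    expCoeff u' φ = expCoeff u φ / invFactProd u * invFactProd u' := by
  have h1 := h.expCoeff_mul hA hs.le
  rw [if_pos hs] at h1
  have := cast_invFactProd_ne_zero u
  field_simp
  linear_combination h1

/-- The exponents of a rational solution are not negative both at the first and last index. -/
theorem IsRationalSolution.negSupp_ne (hm : 1 ≤ m) (hk : StrictMono k) (hk0 : k 0 = 0)
    {α : Fin 2 → ℂ} {φ : RatFun (m + 2)} (h : IsRationalSolution (curveMatrix k) α φ)
    {u : Fin (m + 2) → ℤ} (hu : expCoeff u φ ≠ 0) : negSupp u ≠ {0, Fin.last _} := by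
  classical
  intro hs
  -- After scaling by a constant, the whole expansion of `φ` is the class of `{0, d}`: an exponent
  -- of `φ` has negative support inside `{0, d}`, and a strictly smaller one would kill the
  -- coefficient at `u`.
  let c : (Fin (m + 2) → ℤ) → ℚ := fun u' =>
    if (curveMatrix k).mulVec u = (curveMatrix k).mulVec u' ∧ negSupp u' = {0, Fin.last _} then
      invFactProd u' else 0
  have hc : ∀ u', expCoeff u' ((expCoeff u φ / invFactProd u)⁻¹ • φ) = c u' := by
    intro u'
    have hne : expCoeff u φ / invFactProd u ≠ 0 := div_ne_zero hu (cast_invFactProd_ne_zero _)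
    rw [map_smul, smul_eq_mul, inv_mul_eq_iff_eq_mul₀ hne]
    by_cases hu' : (curveMatrix k).mulVec u = (curveMatrix k).mulVec u' ∧
        negSupp u' = {0, Fin.last _}
    · rw [h.expCoeff_mul_of_negSupp_eq hu'.1 (hs.trans hu'.2.symm),
        show c u' = invFactProd u' from if_pos hu']
    · rw [show c u' = 0 from if_neg hu', Rat.cast_zero, mul_zero]
      by_contra h0
      have hA := h.mulVec_eq_mulVec hu h0
      refine hu' ⟨hA, ?_⟩
      rw [h.negSupp_subset_of_ne_zero hA.symm (hs ▸ h.negSupp_subset hk hk0 h0) hu, hs]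
  obtain ⟨N, hN⟩ := exists_padicNorm_expCoeff_le_one hc
  -- The index `1` is a middle index because `m ≥ 1`. Without middle variables the class could not
  -- acquire denominators in this way.
  have h0 : (1 : Fin (m + 2)) ≠ 0 := by
    rw [Ne, Fin.ext_iff]; simp
  have hl : (1 : Fin (m + 2)) ≠ Fin.last _ := by
    rw [Ne, Fin.ext_iff, Fin.val_last, Fin.val_one]; omega
  obtain ⟨p, hp, hNp, u', hA, hs', hlt⟩ :=
    exists_one_lt_padicNorm_invFactProd hk hk0 h0 hl hs N
  refine absurd (hN p hp hNp u') (not_le.2 ?_)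
  rwa [show c u' = invFactProd u' from if_pos ⟨hA.symm, hs'⟩]

theorem IsRationalSolution.exists_expCoeff_eq {n r : ℕ} {A : Matrix (Fin n) (Fin r) ℤ}
    {α : Fin n → ℂ} {φ : RatFun r} (h : IsRationalSolution A α φ) (β : Fin n → ℤ)
    (I : Finset (Fin r)) :
    ∃ c : ℂ, ∀ u, A.mulVec u = β → negSupp u = I → expCoeff u φ = c * invFactProd u := by
  by_cases hI : ∃ u, A.mulVec u = β ∧ negSupp u = I
  · obtain ⟨u, hu, hs⟩ := hI
    exact ⟨_, fun u' hu' hs' => h.expCoeff_mul_of_negSupp_eq (hu.trans hu'.symm)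
      (hs.trans hs'.symm)⟩
  · push Not at hI
    exact ⟨0, fun u hu hs => absurd hs (hI u hu)⟩

theorem mem_expSemigroup_iff {n r : ℕ} {A : Matrix (Fin n) (Fin r) ℤ} {α : Fin n → ℤ} :
    α ∈ expSemigroup A ↔ ∃ u, A.mulVec u = α ∧ negSupp u = ∅ := by
  constructor
  · rintro ⟨u, hu⟩
    exact ⟨_, hu, by simp [negSupp]⟩
  · rintro ⟨u, hu, hs⟩
    have h : ∀ j, 0 ≤ u j := fun j => not_lt.1 fun hj => by
      simpa [hs] using mem_negSupp.2 hj
    refine ⟨fun j => (u j).toNat, ?_⟩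
    simp only [Int.toNat_of_nonneg (h _)]
    exact hu

theorem IsRationalSolution.mulVec_eq_of_intCast {n r : ℕ} {A : Matrix (Fin n) (Fin r) ℤ}
    {α : Fin n → ℤ} {φ : RatFun r} (h : IsRationalSolution A (fun i => (α i : ℂ)) φ)
    {u : Fin r → ℤ} (hu : expCoeff u φ ≠ 0) : A.mulVec u = α := by
  funext i
  exact_mod_cast congrFun (h.mulVec_eq hu) i

/-- The empty negative support occurs in the fibre of `α` and lies in every other one, so only its
class can carry nonzero coefficients. -/
theorem IsRationalSolution.expCoeff_eq_of_mem {n r : ℕ} {A : Matrix (Fin n) (Fin r) ℤ}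
    {α : Fin n → ℤ} {φ : RatFun r} (h : IsRationalSolution A (fun i => (α i : ℂ)) φ)
    (hα : α ∈ expSemigroup A) :
    ∃ c : ℂ, ∀ u, expCoeff u φ = c * classCoeff A α ∅ u := by
  obtain ⟨u₀, hu₀, hs₀⟩ := mem_expSemigroup_iff.1 hα
  obtain ⟨c, hc⟩ := h.exists_expCoeff_eq α ∅
  refine ⟨c, fun u => ?_⟩
  by_cases hu : A.mulVec u = α ∧ negSupp u = ∅
  · rw [hc u hu.1 hu.2, classCoeff_of_mem hu.1 hu.2]
  · rw [classCoeff_of_notMem hu, mul_zero]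
    by_contra h0
    have hA := h.mulVec_eq_of_intCast h0
    refine hu ⟨hA, ?_⟩
    rw [← h.negSupp_subset_of_ne_zero (hu₀.trans hA.symm) (by simp [hs₀]) h0, hs₀]

/-- Of the four subsets of `{0, d}`, the empty one would put `α` in the semigroup and the full one
is excluded by `IsRationalSolution.negSupp_ne`. -/
theorem IsRationalSolution.expCoeff_eq_of_notMem (hm : 1 ≤ m) (hk : StrictMono k) (hk0 : k 0 = 0)
    {α : Fin 2 → ℤ} {φ : RatFun (m + 2)}
    (h : IsRationalSolution (curveMatrix k) (fun i => (α i : ℂ)) φ)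
    (hα : α ∉ expSemigroup (curveMatrix k)) :
    ∃ c₀ c_d : ℂ, ∀ u, expCoeff u φ = c₀ * classCoeff (curveMatrix k) α {0} u +
      c_d * classCoeff (curveMatrix k) α {Fin.last _} u := by
  obtain ⟨c₀, hc₀⟩ := h.exists_expCoeff_eq α {0}
  obtain ⟨c_d, hc_d⟩ := h.exists_expCoeff_eq α {Fin.last _}
  have hne : ({0} : Finset (Fin (m + 2))) ≠ {Fin.last _} := by
    rw [Ne, Finset.singleton_inj]
    exact (Fin.last_pos).ne
  refine ⟨c₀, c_d, fun u => ?_⟩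
  by_cases hu : expCoeff u φ = 0
  · have h1 : c₀ * classCoeff (curveMatrix k) α {0} u = 0 := by
      by_cases h' : (curveMatrix k).mulVec u = α ∧ negSupp u = {0}
      · rw [classCoeff_of_mem h'.1 h'.2, ← hc₀ u h'.1 h'.2, hu]
      · rw [classCoeff_of_notMem h', mul_zero]
    have h2 : c_d * classCoeff (curveMatrix k) α {Fin.last _} u = 0 := by
      by_cases h' : (curveMatrix k).mulVec u = α ∧ negSupp u = {Fin.last _}
      · rw [classCoeff_of_mem h'.1 h'.2, ← hc_d u h'.1 h'.2, hu]
      · rw [classCoeff_of_notMem h', mul_zero]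
    rw [hu, h1, h2, add_zero]
  · have hA := h.mulVec_eq_of_intCast hu
    have hs := h.negSupp_subset hk hk0 hu
    rw [← Finset.coe_subset, Finset.coe_pair, Set.subset_pair_iff_eq] at hs
    norm_cast at hs
    rcases hs with hs | hs | hs | hs
    · exact absurd (mem_expSemigroup_iff.2 ⟨u, hA, hs⟩) hα
    · rw [classCoeff_of_mem hA hs, classCoeff_of_notMem fun h' => hne (hs.symm.trans h'.2),
        mul_zero, add_zero, hc₀ u hA hs]
    · rw [classCoeff_of_mem hA hs,
        classCoeff_of_notMem (I := {0}) fun h' => hne (h'.2.symm.trans hs),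
        mul_zero, zero_add, hc_d u hA hs]
    · exact absurd hs (h.negSupp_ne hm hk hk0 hu)

end GKZ

end

/-! ### Coefficients of `Φ`, `Ψ_0` and `Ψ_d`. -/

noncomputable section

namespace GKZ

open MvPolynomial

theorem ofPoly_zero {r : ℕ} : ofPoly (0 : MvPolynomial (Fin r) ℂ) = 0 := map_zero _

theorem ofPoly_add {r : ℕ} (P Q : MvPolynomial (Fin r) ℂ) :
    ofPoly (P + Q) = ofPoly P + ofPoly Q := map_add _ _ _

theorem ofPoly_mul {r : ℕ} (P Q : MvPolynomial (Fin r) ℂ) :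
    ofPoly (P * Q) = ofPoly P * ofPoly Q := map_mul _ _ _

theorem ofPoly_pow {r : ℕ} (P : MvPolynomial (Fin r) ℂ) (n : ℕ) :
    ofPoly (P ^ n) = ofPoly P ^ n := map_pow _ _ _

theorem ofPoly_smul {r : ℕ} (c : ℂ) (P : MvPolynomial (Fin r) ℂ) :
    ofPoly (c • P) = c • ofPoly P := map_smul (IsScalarTower.toAlgHom ℂ _ (RatFun r)) c P

theorem intExp_toNat {r : ℕ} {u : Fin r → ℤ} (hu : negSupp u = ∅) :
    intExp (Finsupp.equivFunOnFinite.symm fun j => (u j).toNat) = u := by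
  funext j
  have : ¬ u j < 0 := fun hj => by simpa [hu] using mem_negSupp.2 hj
  simp only [intExp, Finsupp.equivFunOnFinite_symm_apply_apply]
  omega

theorem negSupp_intExp {r : ℕ} (n : Fin r →₀ ℕ) : negSupp (intExp n) = ∅ := by
  simp [Finset.ext_iff, mem_negSupp, intExp]

theorem coeff_hypPoly {n r : ℕ} {A : Matrix (Fin n) (Fin r) ℤ} {α : Fin n → ℤ}
    (hfin : {u : Fin r →₀ ℕ | A.mulVec (fun j => (u j : ℤ)) = α}.Finite) (u : Fin r →₀ ℕ) :
    (hypPoly A α).coeff u = classCoeff A α ∅ (intExp u) := by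
  classical
  have h : hypPoly A α = ∑ u ∈ hfin.toFinset,
      monomial u ((∏ j, ((u j).factorial : ℂ))⁻¹) :=
    finsum_mem_eq_finite_toFinset_sum _ hfin
  rw [h, coeff_sum]
  simp only [coeff_monomial, Finset.sum_ite_eq', Set.Finite.mem_toFinset, Set.mem_ofPred_eq]
  by_cases hu : A.mulVec (intExp u) = α
  · refine (if_pos hu).trans ?_
    rw [classCoeff_of_mem hu (negSupp_intExp u), invFactProd]
    simp [intExp, invFact_natCast]
  · refine (if_neg hu).trans ?_
    rw [classCoeff_of_notMem fun h' => hu h'.1]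

theorem expCoeff_hypPoly {n r : ℕ} {A : Matrix (Fin n) (Fin r) ℤ} {α : Fin n → ℤ}
    (hfin : {u : Fin r →₀ ℕ | A.mulVec (fun j => (u j : ℤ)) = α}.Finite) (u : Fin r → ℤ) :
    expCoeff u (ofPoly (hypPoly A α)) = classCoeff A α ∅ u := by
  by_cases hu : negSupp u = ∅
  · rw [← intExp_toNat hu, expCoeff_ofPoly, coeff_hypPoly hfin]
  · rw [classCoeff_of_notMem fun h' => hu h'.2, expCoeff_ofPoly_eq_zero]
    rintro n rfl
    exact absurd (negSupp_intExp n) hu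

theorem expCoeff_monomial {r : ℕ} (u : Fin r → ℤ) (n : Fin r →₀ ℕ) (c : ℂ) :
    expCoeff u (ofPoly (monomial n c)) = open Classical in if u = intExp n then c else 0 := by
  rw [expCoeff_apply, expand_ofPoly, polyExpand_monomial, HahnSeries.coeff_single]
  simp only [expDeg_injective.eq_iff]

theorem expCoeff_rename_succAbove {r : ℕ} (i : Fin (r + 1)) (P : MvPolynomial (Fin r) ℂ)
    (u : Fin (r + 1) → ℤ) :
    expCoeff u (ofPoly (rename i.succAbove P)) =
      if u i = 0 then expCoeff (u ∘ i.succAbove) (ofPoly P) else 0 := by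
  classical
  induction P using MvPolynomial.induction_on' with
  | monomial n c =>
    rw [rename_monomial, expCoeff_monomial, expCoeff_monomial, ← ite_and]
    congr 1
    rw [eq_iff_iff, funext_iff, Fin.forall_iff_succAbove i, funext_iff]
    refine and_congr ?_ (forall_congr' fun j => ?_)
    · rw [intExp, Finsupp.mapDomain_of_notMem_range]
      · simp
      · rintro ⟨j, hj⟩
        exact Fin.succAbove_ne i j hj
    · simp only [intExp, Function.comp_apply]
      rw [Finsupp.mapDomain_apply Fin.succAbove_right_injective]
  | add p q hp hq =>
    simp only [map_add, hp, hq]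
    split_ifs <;> simp

/-- The common generalization of `psiZero` and `psiLast`, for any variable `x_i`. -/
def psiAt {n r : ℕ} (i : Fin (r + 1)) (A : Matrix (Fin n) (Fin (r + 1)) ℤ) (α : Fin n → ℤ) :
    RatFun (r + 1) :=
  ∑ᶠ (s : ℕ) (_ : 1 ≤ s), ((-1) ^ s * ((s - 1).factorial : ℂ)) •
    (ofPoly (rename i.succAbove
      (hypPoly (A.submatrix id i.succAbove) (α + (s : ℤ) • fun l => A l i))) / var i ^ s)

theorem psiLast_eq_psiAt {n r : ℕ} (A : Matrix (Fin n) (Fin (r + 1)) ℤ) (α : Fin n → ℤ) :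
    psiLast A α = psiAt (Fin.last r) A α := by
  simp only [psiLast, psiAt, Fin.succAbove_last]

theorem psiZero_eq_psiAt {n r : ℕ} (A : Matrix (Fin n) (Fin (r + 1)) ℤ) (α : Fin n → ℤ) :
    psiZero A α = psiAt 0 A α := by
  simp only [psiZero, psiAt, Fin.succAbove_zero]

theorem negSupp_eq_singleton_iff {r : ℕ} {i : Fin (r + 1)} {u : Fin (r + 1) → ℤ} :
    negSupp u = {i} ↔ u i < 0 ∧ negSupp (u ∘ i.succAbove) = ∅ := by
  rw [Finset.ext_iff, Fin.forall_iff_succAbove i, Finset.eq_empty_iff_forall_notMem]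
  simp [mem_negSupp]

theorem submatrix_succAbove_mulVec {n r : ℕ} (A : Matrix (Fin n) (Fin (r + 1)) ℤ)
    (i : Fin (r + 1)) (u : Fin (r + 1) → ℤ) :
    (A.submatrix id i.succAbove).mulVec (u ∘ i.succAbove) =
      A.mulVec u + (-u i) • fun l => A l i := by
  funext l
  simp only [Matrix.mulVec, dotProduct, Pi.add_apply, Pi.smul_apply,
    Fin.sum_univ_succAbove _ i, Matrix.submatrix_apply, id, Function.comp_apply, smul_eq_mul]
  ring

/-- The `s`-th summand collects the exponents with `u i = -s`, and its scalar `(-1)^s (s-1)!` is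
`γ(-s)`. -/
theorem expCoeff_psiAt_term {n r : ℕ} {i : Fin (r + 1)} {A : Matrix (Fin n) (Fin (r + 1)) ℤ}
    {α : Fin n → ℤ} {s : ℕ} (hs : 1 ≤ s)
    (hfin : {u : Fin r →₀ ℕ | (A.submatrix id i.succAbove).mulVec (fun j => (u j : ℤ)) =
      α + (s : ℤ) • fun l => A l i}.Finite) (u : Fin (r + 1) → ℤ) :
    expCoeff u (((-1) ^ s * ((s - 1).factorial : ℂ)) •
    (ofPoly (rename i.succAbove
      (hypPoly (A.submatrix id i.succAbove) (α + (s : ℤ) • fun l => A l i))) / var i ^ s)) =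
      if u i = -s then classCoeff A α {i} u else 0 := by
  have hcomp : (u + (s : ℤ) • (Pi.single i 1 : Fin (r + 1) → ℤ)) ∘ i.succAbove
      = u ∘ i.succAbove := by
    funext j
    simp [Fin.succAbove_ne]
  have hi : (u + (s : ℤ) • (Pi.single i 1 : Fin (r + 1) → ℤ)) i = 0 ↔ u i = -s := by
    simp [add_eq_zero_iff_eq_neg]
  rw [map_smul, expCoeff_div_var_pow, expCoeff_rename_succAbove, hcomp, expCoeff_hypPoly hfin]
  simp only [hi, smul_eq_mul]
  split_ifs with h
  · have hA : (A.submatrix id i.succAbove).mulVec (u ∘ i.succAbove) =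
        α + (s : ℤ) • (fun l => A l i) ↔ A.mulVec u = α := by
      rw [submatrix_succAbove_mulVec, h, neg_neg, add_left_inj]
    have hneg : negSupp u = {i} ↔ negSupp (u ∘ i.succAbove) = ∅ := by
      rw [negSupp_eq_singleton_iff, and_iff_right]
      omega
    by_cases hu : A.mulVec u = α ∧ negSupp u = {i}
    · rw [classCoeff_of_mem hu.1 hu.2, classCoeff_of_mem (hA.2 hu.1) (hneg.1 hu.2),
        invFactProd, invFactProd, Fin.prod_univ_succAbove _ i]
      -- `Int.negSucc n` is `-(n + 1)`, which accounts for `(s - 1)!`.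
      have : u i = Int.negSucc (s - 1) := by rw [h, Int.negSucc_eq]; omega
      rw [this, invFact_negSucc, Nat.sub_add_cancel hs]
      simp
    · rw [classCoeff_of_notMem hu, classCoeff_of_notMem, mul_zero]
      rwa [hA, ← hneg]
  · rw [mul_zero]

theorem expCoeff_psiAt {n r : ℕ} {i : Fin (r + 1)} {A : Matrix (Fin n) (Fin (r + 1)) ℤ}
    {α : Fin n → ℤ}
    (hfin : ∀ β, {u : Fin r →₀ ℕ | (A.submatrix id i.succAbove).mulVec (fun j => (u j : ℤ)) =
      β}.Finite)
    (hs : {s : ℕ | hypPoly (A.submatrix id i.succAbove)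
      (α + (s : ℤ) • fun l => A l i) ≠ 0}.Finite) (u : Fin (r + 1) → ℤ) :
    expCoeff u (psiAt i A α) = classCoeff A α {i} u := by
  have h1 := (expCoeff (r := r + 1) u).toAddMonoidHom.map_finsum_mem' (s := {s : ℕ | 1 ≤ s})
    (f := fun s => ((-1) ^ s * ((s - 1).factorial : ℂ)) •
    (ofPoly (rename i.succAbove
      (hypPoly (A.submatrix id i.succAbove) (α + (s : ℤ) • fun l => A l i))) / var i ^ s))
    -- Only finitely many summands are nonzero, so taking a coefficient commutes with the sum;
    -- otherwise `finsum` would have the default value `0`.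
    (hs.subset fun s hs' h0 => hs'.2 (by
      simp only
      rw [h0, map_zero, ofPoly_zero, zero_div, smul_zero]))
  refine h1.trans ?_
  have h2 : ∀ s ∈ {s : ℕ | 1 ≤ s}, (expCoeff (r := r + 1) u).toAddMonoidHom
      (((-1) ^ s * ((s - 1).factorial : ℂ)) •
    (ofPoly (rename i.succAbove
      (hypPoly (A.submatrix id i.succAbove) (α + (s : ℤ) • fun l => A l i))) / var i ^ s)) =
      if u i = -s then classCoeff A α {i} u else 0 :=
    fun s hs => expCoeff_psiAt_term hs (hfin _) u
  rw [finsum_mem_congr rfl h2]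
  by_cases hu : u i < 0
  · obtain ⟨s₀, hs₀⟩ : ∃ s₀ : ℕ, u i = -s₀ := ⟨(u i).natAbs, by omega⟩
    rw [finsum_eq_single _ s₀]
    · rw [finsum_eq_if, if_pos (by simp only [Set.mem_ofPred_eq]; omega), if_pos hs₀]
    · intro s hs
      rw [if_neg (by omega), finsum_eq_if, ite_self]
  · rw [classCoeff_of_notMem fun h' => hu (negSupp_eq_singleton_iff.1 h'.2).1]
    simp

variable {m : ℕ} {k : Fin (m + 2) → ℕ}

theorem expCoeff_hypPoly_curveMatrix (α : Fin 2 → ℤ) (u : Fin (m + 2) → ℤ) :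
    expCoeff u (ofPoly (hypPoly (curveMatrix k) α)) = classCoeff (curveMatrix k) α ∅ u :=
  expCoeff_hypPoly (hypPoly_finite k α) u

theorem hypPoly_finite_submatrix {r l : ℕ} (k : Fin r → ℕ) (f : Fin l → Fin r)
    (α : Fin 2 → ℤ) : {u : Fin l →₀ ℕ | ((curveMatrix k).submatrix id f).mulVec
      (fun j => (u j : ℤ)) = α}.Finite := by
  have h : (curveMatrix k).submatrix id f = curveMatrix (k ∘ f) := by
    ext i j
    fin_cases i <;> rfl
  rw [h]
  exact hypPoly_finite _ _

theorem expCoeff_psiLast (hk : StrictMono k) (α : Fin 2 → ℤ) (u : Fin (m + 2) → ℤ) :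
    expCoeff u (psiLast (curveMatrix k) α) = classCoeff (curveMatrix k) α {Fin.last _} u := by
  rw [psiLast_eq_psiAt]
  refine expCoeff_psiAt (hypPoly_finite_submatrix k _) ?_ u
  rw [Fin.succAbove_last]
  exact psiLast_finite k hk α

theorem expCoeff_psiZero (hk : StrictMono k) (hk0 : k 0 = 0) (α : Fin 2 → ℤ)
    (u : Fin (m + 2) → ℤ) :
    expCoeff u (psiZero (curveMatrix k) α) = classCoeff (curveMatrix k) α {0} u := by
  rw [psiZero_eq_psiAt]
  refine expCoeff_psiAt (hypPoly_finite_submatrix k _) ?_ u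
  exact psiZero_finite k hk hk0 α

theorem isRationalSolution_hypPoly (α : Fin 2 → ℤ) :
    IsRationalSolution (curveMatrix k) (fun i => (α i : ℂ))
      (ofPoly (hypPoly (curveMatrix k) α)) :=
  isRationalSolution_of_expCoeff (expCoeff_hypPoly_curveMatrix α)
    fun _ _ h => Finset.subset_empty.1 h

/-- Outside the semigroup the empty support does not occur, so singletons are minimal. This is the
hypothesis that makes `Ψ_0` and `Ψ_d` solutions. -/
theorem negSupp_eq_singleton_of_subset {n r : ℕ} {A : Matrix (Fin n) (Fin r) ℤ} {α : Fin n → ℤ}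
    (hα : α ∉ expSemigroup A) {u : Fin r → ℤ} (hu : A.mulVec u = α) {i : Fin r}
    (h : negSupp u ⊆ {i}) : negSupp u = {i} :=
  (Finset.subset_singleton_iff.1 h).resolve_left fun h0 =>
    hα (mem_expSemigroup_iff.2 ⟨u, hu, h0⟩)

theorem isRationalSolution_psiLast (hk : StrictMono k) {α : Fin 2 → ℤ}
    (hα : α ∉ expSemigroup (curveMatrix k)) :
    IsRationalSolution (curveMatrix k) (fun i => (α i : ℂ)) (psiLast (curveMatrix k) α) :=
  isRationalSolution_of_expCoeff (expCoeff_psiLast hk α)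
    fun _ hu h => negSupp_eq_singleton_of_subset hα hu h

theorem isRationalSolution_psiZero (hk : StrictMono k) (hk0 : k 0 = 0) {α : Fin 2 → ℤ}
    (hα : α ∉ expSemigroup (curveMatrix k)) :
    IsRationalSolution (curveMatrix k) (fun i => (α i : ℂ)) (psiZero (curveMatrix k) α) :=
  isRationalSolution_of_expCoeff (expCoeff_psiZero hk hk0 α)
    fun _ hu h => negSupp_eq_singleton_of_subset hα hu h

/-! ### Laurent polynomials and reduced denominators. -/

/-- The rational functions whose denominator is a monomial in `x_i` and `x_j`. -/
def monomialDenom {r : ℕ} (i j : Fin r) : Submodule ℂ (RatFun r) where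
  carrier := {φ | ∃ (a b : ℕ) (P : MvPolynomial (Fin r) ℂ),
    φ * ofPoly (X i ^ a * X j ^ b) = ofPoly P}
  zero_mem' := ⟨0, 0, 0, by simp⟩
  add_mem' := by
    rintro φ ψ ⟨a, b, P, h⟩ ⟨a', b', P', h'⟩
    refine ⟨a + a', b + b', P * (X i ^ a' * X j ^ b') + P' * (X i ^ a * X j ^ b), ?_⟩
    simp only [ofPoly_add, ofPoly_mul, ofPoly_pow] at h h' ⊢
    rw [← h, ← h']
    ring
  smul_mem' := by
    rintro c φ ⟨a, b, P, h⟩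
    refine ⟨a, b, c • P, ?_⟩
    rw [smul_mul_assoc, h, ofPoly_smul]

theorem ofPoly_mem_monomialDenom {r : ℕ} (i j : Fin r) (P : MvPolynomial (Fin r) ℂ) :
    ofPoly P ∈ monomialDenom i j := ⟨0, 0, P, by simp⟩

theorem var_ne_zero {r : ℕ} (i : Fin r) : (var i : RatFun r) ≠ 0 :=
  (map_ne_zero_iff _ (IsFractionRing.injective _ _)).2 (X_ne_zero i)

theorem psiAt_mem {n r : ℕ} {i : Fin (r + 1)} {A : Matrix (Fin n) (Fin (r + 1)) ℤ}
    {α : Fin n → ℤ} {W : Submodule ℂ (RatFun (r + 1))}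
    (h : ∀ (s : ℕ) (P : MvPolynomial (Fin (r + 1)) ℂ), ofPoly P / var i ^ s ∈ W) :
    psiAt i A α ∈ W :=
  finsum_mem_induction (· ∈ W) W.zero_mem (fun _ _ => W.add_mem)
    fun s _ => W.smul_mem _ (h s _)

theorem psiLast_mem_monomialDenom {n r : ℕ} (A : Matrix (Fin n) (Fin (r + 1)) ℤ)
    (α : Fin n → ℤ) : psiLast A α ∈ monomialDenom 0 (Fin.last r) := by
  rw [psiLast_eq_psiAt]
  refine psiAt_mem fun s P => ⟨0, s, P, ?_⟩
  have := var_ne_zero (Fin.last r)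
  rw [pow_zero, one_mul, ofPoly_pow, div_mul_cancel₀ _ (pow_ne_zero _ this)]

theorem psiZero_mem_monomialDenom {n r : ℕ} (A : Matrix (Fin n) (Fin (r + 1)) ℤ)
    (α : Fin n → ℤ) : psiZero A α ∈ monomialDenom 0 (Fin.last r) := by
  rw [psiZero_eq_psiAt]
  refine psiAt_mem fun s P => ⟨s, 0, P, ?_⟩
  have := var_ne_zero (0 : Fin (r + 1))
  rw [pow_zero, mul_one, ofPoly_pow, div_mul_cancel₀ _ (pow_ne_zero _ this)]

theorem monomialDenom_le_laurentPolynomials {r : ℕ} (i j : Fin r) :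
    monomialDenom i j ≤ laurentPolynomials r := by
  rintro φ ⟨a, b, P, h⟩
  have hi := var_ne_zero i
  have hj := var_ne_zero j
  have h1 : φ = ofPoly P * (var i ^ (-(a : ℤ)) * var j ^ (-(b : ℤ))) := by
    rw [← h, ofPoly_mul, ofPoly_pow, ofPoly_pow, zpow_neg, zpow_neg, zpow_natCast, zpow_natCast]
    field_simp
  have key : ∀ (n : Fin r →₀ ℕ) (c : ℂ),
      ofPoly (monomial n c) * (var i ^ (-(a : ℤ)) * var j ^ (-(b : ℤ))) ∈
        laurentPolynomials r := by
    intro n c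
    have hv : ∀ (l : Fin r) (e : ℤ), (var l : RatFun r) ^ e =
        ∏ x, var x ^ (Pi.single l e : Fin r → ℤ) x := by
      intro l e
      rw [Finset.prod_eq_single l (fun x _ hx => by simp [hx]) (by simp), Pi.single_eq_same]
    have hn : (ofPoly (monomial n c) : RatFun r) = c • ∏ x, var x ^ intExp n x := by
      rw [monomial_eq, Finsupp.prod_fintype _ _ (by simp), ofPoly, map_mul, map_prod,
        Algebra.smul_def]
      simp only [map_pow, intExp, zpow_natCast]
      rfl
    rw [hn, hv, hv, smul_mul_assoc, ← Finset.prod_mul_distrib, ← Finset.prod_mul_distrib]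
    refine Submodule.smul_mem _ _ (Submodule.subset_span
      ⟨intExp n + (Pi.single i (-(a : ℤ)) + Pi.single j (-(b : ℤ))), ?_⟩)
    refine Finset.prod_congr rfl fun x _ => ?_
    rw [Pi.add_apply, Pi.add_apply, zpow_add₀ (var_ne_zero x), zpow_add₀ (var_ne_zero x)]
  rw [h1]
  clear h h1
  induction P using MvPolynomial.induction_on' with
  | monomial n c => exact key n c
  | add p q hp hq =>
    rw [ofPoly_add, add_mul]
    exact Submodule.add_mem _ hp hq

/-- If `φ` times a monomial is a polynomial, the reduced denominator divides numerator times
monomial, and it is coprime to the numerator. -/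
theorem den_dvd_of_mem_monomialDenom {r : ℕ} {i j : Fin r} {φ : RatFun r}
    (h : φ ∈ monomialDenom i j) :
    ∃ a b : ℕ, (IsFractionRing.den (MvPolynomial (Fin r) ℂ) φ : MvPolynomial (Fin r) ℂ) ∣
      X i ^ a * X j ^ b := by
  obtain ⟨a, b, P, h⟩ := h
  refine ⟨a, b, ?_⟩
  have h1 := IsFractionRing.mk'_num_den' (MvPolynomial (Fin r) ℂ) φ
  have h2 : (algebraMap (MvPolynomial (Fin r) ℂ) (RatFun r))
      (IsFractionRing.den (MvPolynomial (Fin r) ℂ) φ) ≠ 0 :=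
    (map_ne_zero_iff _ (IsFractionRing.injective _ _)).2 (nonZeroDivisors.coe_ne_zero _)
  rw [div_eq_iff h2] at h1
  have h3 : IsFractionRing.num (MvPolynomial (Fin r) ℂ) φ * (X i ^ a * X j ^ b) =
      P * (IsFractionRing.den (MvPolynomial (Fin r) ℂ) φ : MvPolynomial (Fin r) ℂ) := by
    apply IsFractionRing.injective (MvPolynomial (Fin r) ℂ) (RatFun r)
    rw [map_mul, h1]
    refine Eq.trans ?_ (ofPoly_mul P _).symm
    rw [← h]
    ring
  exact (IsFractionRing.num_den_reduced (MvPolynomial (Fin r) ℂ) φ).symm.dvd_of_dvd_mul_left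
    (Dvd.intro_left _ h3.symm)

end GKZ

end

/-! ### The classification of rational solutions. -/

noncomputable section

namespace GKZ

variable {m : ℕ} {k : Fin (m + 2) → ℕ}

theorem isRationalSolution_iff_of_mem {α : Fin 2 → ℤ} (hα : α ∈ expSemigroup (curveMatrix k))
    (φ : RatFun (m + 2)) :
    IsRationalSolution (curveMatrix k) (fun i => (α i : ℂ)) φ ↔
      ∃ c : ℂ, φ = c • ofPoly (hypPoly (curveMatrix k) α) := by
  constructor
  · intro h
    obtain ⟨c, hc⟩ := h.expCoeff_eq_of_mem hα
    refine ⟨c, expCoeff_ext fun u => ?_⟩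
    rw [hc, map_smul, expCoeff_hypPoly_curveMatrix, smul_eq_mul]
  · rintro ⟨c, rfl⟩
    exact (isRationalSolution_hypPoly α).smul c

theorem isRationalSolution_iff_of_notMem (hm : 1 ≤ m) (hk : StrictMono k) (hk0 : k 0 = 0)
    {α : Fin 2 → ℤ} (hα : α ∉ expSemigroup (curveMatrix k)) (φ : RatFun (m + 2)) :
    IsRationalSolution (curveMatrix k) (fun i => (α i : ℂ)) φ ↔
      ∃ c₀ c_d : ℂ, φ = c₀ • psiZero (curveMatrix k) α + c_d • psiLast (curveMatrix k) α := by
  constructor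
  · intro h
    obtain ⟨c₀, c_d, hc⟩ := h.expCoeff_eq_of_notMem hm hk hk0 hα
    refine ⟨c₀, c_d, expCoeff_ext fun u => ?_⟩
    rw [hc, map_add, map_smul, map_smul, expCoeff_psiZero hk hk0, expCoeff_psiLast hk,
      smul_eq_mul, smul_eq_mul]
  · rintro ⟨c₀, c_d, rfl⟩
    exact ((isRationalSolution_psiZero hk hk0 hα).smul c₀).add
      ((isRationalSolution_psiLast hk hα).smul c_d)

theorem isRationalSolution_iff_of_not_int {n r : ℕ} {A : Matrix (Fin n) (Fin r) ℤ} {α : Fin n → ℂ}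
    (hα : ¬ ∃ a : Fin n → ℤ, α = fun i => (a i : ℂ)) (φ : RatFun r) :
    IsRationalSolution A α φ ↔ φ = 0 := by
  constructor
  · intro h
    refine expCoeff_ext fun u => ?_
    rw [map_zero]
    by_contra hu
    exact hα ⟨_, (h.mulVec_eq hu).symm⟩
  · rintro rfl
    exact ⟨fun v _ => map_zero _, fun i => by simp⟩

theorem IsRationalSolution.mem_monomialDenom (hm : 1 ≤ m) (hk : StrictMono k) (hk0 : k 0 = 0)
    {α : Fin 2 → ℂ} {φ : RatFun (m + 2)} (h : IsRationalSolution (curveMatrix k) α φ) :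
    φ ∈ monomialDenom 0 (Fin.last (m + 1)) := by
  by_cases hα : ∃ a : Fin 2 → ℤ, α = fun i => (a i : ℂ)
  · obtain ⟨a, rfl⟩ := hα
    by_cases ha : a ∈ expSemigroup (curveMatrix k)
    · obtain ⟨c, rfl⟩ := (isRationalSolution_iff_of_mem ha φ).1 h
      exact Submodule.smul_mem _ _ (ofPoly_mem_monomialDenom _ _ _)
    · obtain ⟨c₀, c_d, rfl⟩ := (isRationalSolution_iff_of_notMem hm hk hk0 ha φ).1 h
      exact Submodule.add_mem _ (Submodule.smul_mem _ _ (psiZero_mem_monomialDenom _ _))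
        (Submodule.smul_mem _ _ (psiLast_mem_monomialDenom _ _))
  · rw [(isRationalSolution_iff_of_not_int hα φ).1 h]
    exact Submodule.zero_mem _

end GKZ

end

theorem theorem1p10 (m : ℕ) (hm : 1 ≤ m) (k : Fin (m + 2) → ℕ) (hk : StrictMono k)
    (hk0 : k 0 = 0) :
    -- every rational solution is a Laurent polynomial; its denominator is a divisor of a monomial
    -- in the first and the last variable, and has no irreducible factor in common with the
    -- discriminant of the generic polynomial, other than these two variables
    (∀ (α : Fin 2 → ℂ) (φ : GKZ.RatFun (m + 2)),
      GKZ.IsRationalSolution (GKZ.curveMatrix k) α φ →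
        φ ∈ GKZ.laurentPolynomials (m + 2) ∧
        (∃ a b : ℕ, (IsFractionRing.den (MvPolynomial (Fin (m + 2)) ℂ) φ :
            MvPolynomial (Fin (m + 2)) ℂ) ∣
          MvPolynomial.X 0 ^ a * MvPolynomial.X (Fin.last (m + 1)) ^ b) ∧
        ∀ p : MvPolynomial (Fin (m + 2)) ℂ, Irreducible p → p ∣ (GKZ.genericPoly k).discr →
          ¬ Associated p (MvPolynomial.X 0) →
          ¬ Associated p (MvPolynomial.X (Fin.last (m + 1))) →
          ¬ p ∣ (IsFractionRing.den (MvPolynomial (Fin (m + 2)) ℂ) φ :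
            MvPolynomial (Fin (m + 2)) ℂ)) ∧
    -- for a non-integral exponent there is only the zero solution
    (∀ α : Fin 2 → ℂ, (¬ ∃ a : Fin 2 → ℤ, α = fun i => (a i : ℂ)) →
      ∀ φ : GKZ.RatFun (m + 2),
        GKZ.IsRationalSolution (GKZ.curveMatrix k) α φ ↔ φ = 0) ∧
    -- for `α ∈ A · ℕ^(m+2)`: exactly the multiples of the hypergeometric polynomial
    (∀ α : Fin 2 → ℤ, α ∈ GKZ.expSemigroup (GKZ.curveMatrix k) →
      ∀ φ : GKZ.RatFun (m + 2),
        GKZ.IsRationalSolution (GKZ.curveMatrix k) (fun i => (α i : ℂ)) φ ↔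
          ∃ c : ℂ, φ = c • GKZ.ofPoly (GKZ.hypPoly (GKZ.curveMatrix k) α)) ∧
    -- for `α ∉ A · ℕ^(m+2)`: exactly the combinations of the two Laurent polynomials
    (∀ α : Fin 2 → ℤ, α ∉ GKZ.expSemigroup (GKZ.curveMatrix k) →
      ∀ φ : GKZ.RatFun (m + 2),
        GKZ.IsRationalSolution (GKZ.curveMatrix k) (fun i => (α i : ℂ)) φ ↔
          ∃ c₀ c_d : ℂ, φ = c₀ • GKZ.psiZero (GKZ.curveMatrix k) α +
            c_d • GKZ.psiLast (GKZ.curveMatrix k) α) := by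
  refine ⟨fun α φ h => ?_, fun α hα φ => GKZ.isRationalSolution_iff_of_not_int hα φ,
    fun α hα φ => GKZ.isRationalSolution_iff_of_mem hα φ,
    fun α hα φ => GKZ.isRationalSolution_iff_of_notMem hm hk hk0 hα φ⟩
  have hmem := h.mem_monomialDenom hm hk hk0
  obtain ⟨a, b, hab⟩ := GKZ.den_dvd_of_mem_monomialDenom hmem
  refine ⟨GKZ.monomialDenom_le_laurentPolynomials _ _ hmem, ⟨a, b, hab⟩, ?_⟩
  intro p hp _ h0 hl hdvd
  -- An irreducible factor of the denominator is prime and divides a monomial in the first and last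
  -- variable, so it is associated to one of them.
  rcases hp.prime.dvd_or_dvd (hdvd.trans hab) with hd | hd
  · exact h0 (hp.associated_of_dvd (MvPolynomial.X_prime).irreducible
      (hp.prime.dvd_of_dvd_pow hd))
  · exact hl (hp.associated_of_dvd (MvPolynomial.X_prime).irreducible
      (hp.prime.dvd_of_dvd_pow hd))
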